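/- Let $N=U\oplus U(2)\oplus D_4\oplus D_4$, where $U$ has basis $e,f$ with $\langle e,e\rangle=\langle f,f\rangle=0$, $\langle e,f\rangle=1$; $U(2)$ has basis $e',f'$ with $\langle e',e'\rangle=\langle f',f'\rangle=0$, $\langle e',f'\rangle=2$; and $D_4=\{x\in\mathbf Z^4: x_1+x_2+x_3+x_4\equiv 0 \bmod 2\}$ carries the negative of the standard inner product. Let $\rho=\rho_1\oplus\rho_0\oplus\rho_0$ be the isometry of $N$ (with $\rho^2=-1$) given by $$\rho_1(e)=-e-e',\quad \rho_1(f)=f-f',\quad \rho_1(e')=e'+2e,\quad \rho_1(f')=2f-f',$$ $$\rho_0(x_1,x_2,x_3,x_4)=(x_2,-x_1,x_4,-x_3).$$ Let $N^*\subset N\otimes\mathbf Q$ be the dual lattice and $A_N=N^*/N$, with discriminant quadratic form $q_N:A_N\to\mathbf Q/2\mathbf Z$, $q_N(x)=\langle x,x\rangle \bmod 2\mathbf Z$; a vector $\alpha\in A_N$ is isotropic if $q_N(\alpha)=0$ and non-isotropic otherwise. Put $$\Gamma=\{\gamma\in O(N):\gamma\circ\rho=\rho\circ\gamma\},\qquad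 \Gamma(1-i)=\mathrm{Ker}(\Gamma\to O(q_N)).$$ Let $V_+=\{z\in N\otimes\mathbf C:\rho(z)=\sqrt{-1}\,z\}$ and let $\mathcal B=\{z\in\mathbf P(V_+):\langle z,\bar z\rangle>0\}$ be the $5$-dimensional complex ball. The cusps of $\mathcal B$ are its rational boundary points, that is, the points $z\in\mathbf P(V_+)$ with $\langle z,\bar z\rangle=0$ that are spanned by a vector of $N\otimes\mathbf Q(\sqrt{-1})$. Every $x\in N$ has $(x+\rho(x))/2\in N^*$; write $\varphi(x)\in A_N$ for its class. Then: (i) $\Gamma/\Gamma(1-i)\cong S_8$. (ii) $\Gamma$ acts transitively on the set of cusps of $\mathcal B$ and on the set of $\rho$-invariant sublattices $R\subset N$ with $R\cong A_1\oplus A_1$ (where $A_1$ is generated by one vector of norm $-2$). (iii) There is a bijection from the set of $\Gamma(1-i)$-orbits of $\rho$-invariant sublattices $R\cong A_1\oplus A_1$ of $N$ to the set of non-isotropic vectors of $A_N$, which sends the orbit of $R$ to $\varphi(r)$ for every $r\in R$ with $\langle r,r\rangle=-2$; there are exactly $28$ non-isotropic vectors. There is a bijection from the set of $\Gamma(1-i)$-orbits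 of cusps of $\mathcal B$ to the set of non-zero isotropic vectors of $A_N$, which sends the orbit of a cusp $c$ to $\varphi(v)$ whenever $v$ and $\rho(v)$ generate the sublattice $\{x\in N: x-\sqrt{-1}\rho(x) \text{ lies on the line } c\}$; there are exactly $35$ non-zero isotropic vectors. -/

import Mathlib

open scoped TensorProduct LinearAlgebra.Projectivization

noncomputable section

namespace EightPoints

/-! ### The lattice `N = U ⊕ U(2) ⊕ D₄ ⊕ D₄` -/

/-- The underlying group of the root lattice `D₄`: integral vectors with even coordinate sum. -/
def D4 : Submodule ℤ (Fin 4 → ℤ) where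
  carrier := {x | Even (x 0 + x 1 + x 2 + x 3)}
  add_mem' := by
    intro x y hx hy
    have h := Even.add hx hy
    have e : (x + y) 0 + (x + y) 1 + (x + y) 2 + (x + y) 3
        = (x 0 + x 1 + x 2 + x 3) + (y 0 + y 1 + y 2 + y 3) := by
      simp only [Pi.add_apply]; ring
    simpa only [Set.mem_ofPred_eq, e] using h
  zero_mem' := by simp
  smul_mem' := by
    intro c x hx
    have h := Even.mul_left hx c
    have e : (c • x) 0 + (c • x) 1 + (c • x) 2 + (c • x) 3
        = c * (x 0 + x 1 + x 2 + x 3) := by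
      simp only [Pi.smul_apply, smul_eq_mul]; ring
    simpa only [Set.mem_ofPred_eq, e] using h

/-- The underlying group of `N = (U ⊕ U(2)) ⊕ D₄ ⊕ D₄`. The first component lists the coordinates
with respect to the basis `e, f, e', f'` of `U ⊕ U(2)`. -/
abbrev N : Type := (Fin 4 → ℤ) × D4 × D4

/-- The integral symmetric bilinear form of `N`: `⟨e, f⟩ = 1`, `⟨e', f'⟩ = 2`, the other products
of `e, f, e', f'` vanish, and `D₄` is negative definite. -/
def form : LinearMap.BilinForm ℤ N :=
  LinearMap.mk₂ ℤ
    (fun x y => (x.1 0 * y.1 1 + x.1 1 * y.1 0) + 2 * (x.1 2 * y.1 3 + x.1 3 * y.1 2)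
      - ∑ i, x.2.1.1 i * y.2.1.1 i - ∑ i, x.2.2.1 i * y.2.2.1 i)
    (by intros; simp [Fin.sum_univ_four]; ring)
    (by intros; simp [Fin.sum_univ_four]; ring)
    (by intros; simp [Fin.sum_univ_four]; ring)
    (by intros; simp [Fin.sum_univ_four]; ring)

/-- `ρ₀(x₁, x₂, x₃, x₄) = (x₂, -x₁, x₄, -x₃)` on `D₄`. -/
def rhoZero : D4 →ₗ[ℤ] D4 where
  toFun x := ⟨![x.1 1, -x.1 0, x.1 3, -x.1 2], by
    obtain ⟨k, hk⟩ := x.2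
    exact ⟨x.1 1 + x.1 3 - k, by simp; linarith⟩⟩
  map_add' := by
    intro x y; ext i; fin_cases i <;> simp <;> ring
  map_smul' := by
    intro c x; ext i; fin_cases i <;> simp

/-- `ρ₁` on `U ⊕ U(2)`, in the coordinates of the basis `e, f, e', f'`:
`ρ₁ e = -e - e'`, `ρ₁ f = f - f'`, `ρ₁ e' = e' + 2e`, `ρ₁ f' = 2f - f'`. -/
def rhoOne : (Fin 4 → ℤ) →ₗ[ℤ] (Fin 4 → ℤ) where
  toFun x := ![-x 0 + 2 * x 2, x 1 + 2 * x 3, -x 0 + x 2, -x 1 - x 3]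
  map_add' := by
    intro x y; ext i; fin_cases i <;> simp <;> ring
  map_smul' := by
    intro c x; ext i; fin_cases i <;> simp <;> ring

/-- The isometry `ρ = ρ₁ ⊕ ρ₀ ⊕ ρ₀` of `N`. -/
def rho : N →ₗ[ℤ] N := rhoOne.prodMap (rhoZero.prodMap rhoZero)

theorem rho_rho (x : N) : rho (rho x) = -x := by
  obtain ⟨a, b, c⟩ := x
  refine Prod.ext ?_ (Prod.ext ?_ ?_)
  · ext i; fin_cases i <;> simp [rho, rhoOne] <;> ring
  · ext i; fin_cases i <;> simp [rho, rhoZero]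
  · ext i; fin_cases i <;> simp [rho, rhoZero]

theorem form_comm (x y : N) : form x y = form y x := by
  simp [form, Fin.sum_univ_four]; ring

theorem form_rho_rho (x y : N) : form (rho x) (rho y) = form x y := by
  simp [form, rho, rhoOne, rhoZero, Fin.sum_univ_four]; ring

theorem form_self_even (x : N) : Even (form x x) := by
  obtain ⟨k, hk⟩ := x.2.1.2
  obtain ⟨l, hl⟩ := x.2.2.2
  have hs : ∀ s : ℤ, Even (s * (s - 1)) := Int.even_mul_pred_self
  have e : form x x = 2 * (x.1 0 * x.1 1 + 2 * (x.1 2 * x.1 3) - k - l)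
      - (∑ i, x.2.1.1 i * (x.2.1.1 i - 1)) - (∑ i, x.2.2.1 i * (x.2.2.1 i - 1)) := by
    simp only [form, LinearMap.mk₂_apply, Fin.sum_univ_four]
    linarith
  rw [e]
  refine ((even_two_mul _).sub ?_).sub ?_
  · exact Finset.even_sum _ fun i _ => hs _
  · exact Finset.even_sum _ fun i _ => hs _

theorem form_add_rho_even (x y : N) : Even (form (x + rho x) y) := by
  obtain ⟨k, hk⟩ := x.2.1.2
  obtain ⟨k', hk'⟩ := y.2.1.2
  obtain ⟨l, hl⟩ := x.2.2.2
  obtain ⟨l', hl'⟩ := y.2.2.2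
  have key : ∀ (u v : Fin 4 → ℤ) (a b : ℤ), u 0 + u 1 + u 2 + u 3 = a + a →
      v 0 + v 1 + v 2 + v 3 = b + b →
      Even ((u 0 + u 1) * v 0 + (u 1 - u 0) * v 1 + (u 2 + u 3) * v 2 + (u 3 - u 2) * v 3) := by
    intro u v a b hu hv
    have h3 : u 3 = a + a - u 0 - u 1 - u 2 := by linarith
    have h4 : v 3 = b + b - v 0 - v 1 - v 2 := by linarith
    rw [h3, h4]
    exact ⟨-u 0 * v 1 + a * v 2 + (a - u 0 - u 1 - u 2) * (b + b - v 0 - v 1 - v 2)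
      + (u 0 + u 1) * (b - v 2), by ring⟩
  obtain ⟨p, hp⟩ := key _ _ _ _ hk hk'
  obtain ⟨q, hq⟩ := key _ _ _ _ hl hl'
  refine ⟨x.1 2 * y.1 1 + x.1 1 * y.1 0 + x.1 3 * y.1 0 + (-x.1 0 + 2 * x.1 2) * y.1 3
    - x.1 1 * y.1 2 - p - q, ?_⟩
  simp [form, rho, rhoOne, rhoZero, Fin.sum_univ_four]
  linarith

/-! ### The groups `O(N)` and `Γ` -/

/-- The orthogonal group `O(N)`. -/
def orthogonalGroup : Subgroup (N ≃ₗ[ℤ] N) where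
  carrier := {g | ∀ x y, form (g x) (g y) = form x y}
  mul_mem' := by
    intro g h hg hh x y
    simp only [LinearEquiv.mul_apply]
    rw [hg, hh]
  one_mem' := fun _ _ => rfl
  inv_mem' := by
    intro g hg x y
    have h := hg (g⁻¹ x) (g⁻¹ y)
    simpa only [← LinearEquiv.mul_apply, mul_inv_cancel, LinearEquiv.coe_one, id_eq] using h.symm

/-- The group `Γ = {γ ∈ O(N) | γ ∘ ρ = ρ ∘ γ}`. -/
def Gam : Subgroup (N ≃ₗ[ℤ] N) where
  carrier := {g | g ∈ orthogonalGroup ∧ ∀ x, g (rho x) = rho (g x)}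
  mul_mem' := by
    intro g h hg hh
    refine ⟨mul_mem hg.1 hh.1, fun x => ?_⟩
    simp only [LinearEquiv.mul_apply]
    rw [hh.2, hg.2]
  one_mem' := ⟨one_mem _, fun _ => rfl⟩
  inv_mem' := by
    intro g hg
    refine ⟨inv_mem hg.1, fun x => ?_⟩
    apply g.injective
    rw [hg.2]
    simp only [← LinearEquiv.mul_apply, mul_inv_cancel, LinearEquiv.coe_one, id_eq]

theorem Gam_le : Gam ≤ orthogonalGroup := fun _ h => h.1

/-! ### The discriminant group `A_N = N* / N` and its quadratic form -/

/-- `N ⊗ ℚ`. -/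
abbrev NQ : Type := ℚ ⊗[ℤ] N

/-- The rational extension of the form of `N`. -/
def formQ : LinearMap.BilinForm ℚ NQ := form.baseChange ℚ

/-- The inclusion `N → N ⊗ ℚ`. -/
def toNQ : N →ₗ[ℤ] NQ := TensorProduct.mk ℤ ℚ N 1

theorem formQ_tmul (a b : ℚ) (x y : N) : formQ (a ⊗ₜ[ℤ] x) (b ⊗ₜ[ℤ] y) = form x y * (a * b) := by
  rw [← zsmul_eq_mul]
  exact LinearMap.BilinForm.baseChange_tmul (A := ℚ) form a x b y

theorem formQ_toNQ (x y : N) : formQ (toNQ x) (toNQ y) = form x y :=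
  (formQ_tmul 1 1 x y).trans (by simp)

theorem formQ_comm (x y : NQ) : formQ x y = formQ y x := by
  have h : LinearMap.IsSymm (form.baseChange ℚ) := LinearMap.BilinForm.IsSymm.baseChange ℚ ⟨form_comm⟩
  exact h.eq x y

/-- The dual lattice `N*`, as a subgroup of `N ⊗ ℚ`. -/
def dualN : Submodule ℤ NQ where
  carrier := {x | ∀ y : N, ∃ n : ℤ, formQ x (toNQ y) = n}
  add_mem' := by
    intro x x' hx hx' y
    obtain ⟨n, hn⟩ := hx y
    obtain ⟨n', hn'⟩ := hx' y
    exact ⟨n + n', by simp [hn, hn']⟩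
  zero_mem' := fun y => ⟨0, by simp⟩
  smul_mem' := by
    intro c x hx y
    obtain ⟨n, hn⟩ := hx y
    exact ⟨c * n, by simp [hn]⟩

/-- The lattice `N`, as a subgroup of `N*`. -/
def NinDual : Submodule ℤ dualN := (LinearMap.range toNQ).submoduleOf dualN

/-- The discriminant group `A_N = N* / N`. -/
abbrev AN : Type := dualN ⧸ NinDual

/-- The discriminant quadratic form `q_N : A_N → ℚ / 2ℤ`, `q_N(x mod N) = ⟨x, x⟩ mod 2ℤ`. -/
def qN : AN → ℚ ⧸ AddSubgroup.zmultiples (2 : ℚ) :=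
  Quotient.lift (s := Submodule.quotientRel NinDual)
    (fun x : dualN => ((formQ x.1 x.1 : ℚ) : ℚ ⧸ AddSubgroup.zmultiples (2 : ℚ))) (by
      intro a b hab
      have hab' : a - b ∈ NinDual := (Submodule.quotientRel_def NinDual).1 hab
      obtain ⟨n, hn⟩ : ∃ n : N, toNQ n = a.1 - b.1 := hab'
      obtain ⟨k, hk⟩ := b.2 n
      obtain ⟨m, hm⟩ := form_self_even n
      have ha : a.1 = b.1 + toNQ n := by rw [hn]; abel
      refine (QuotientAddGroup.eq).2 (AddSubgroup.mem_zmultiples_iff.2 ⟨-(k + m), ?_⟩)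
      have h1 : formQ (toNQ n) b.1 = k := by rw [formQ_comm]; exact hk
      have h2 : formQ (toNQ n) (toNQ n) = m + m := by rw [formQ_toNQ, hm]; push_cast; ring
      rw [ha]
      simp only [map_add, LinearMap.add_apply, hk, h1, h2, zsmul_eq_mul]
      push_cast
      ring)

/-- The orthogonal group `O(q_N)` of the finite quadratic form `(A_N, q_N)`. -/
def Oq : Subgroup (AN ≃ₗ[ℤ] AN) where
  carrier := {g | ∀ a, qN (g a) = qN a}
  mul_mem' := by
    intro g h hg hh a
    simp only [LinearEquiv.mul_apply]
    rw [hg, hh]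
  one_mem' := fun _ => rfl
  inv_mem' := by
    intro g hg a
    have h := hg (g⁻¹ a)
    simpa only [← LinearEquiv.mul_apply, mul_inv_cancel, LinearEquiv.coe_one, id_eq] using h.symm

/-- The extension of an automorphism of `N` to `N ⊗ ℚ`. -/
def extQ (g : N ≃ₗ[ℤ] N) : NQ ≃ₗ[ℚ] NQ := g.baseChange ℤ ℚ N N

theorem extQ_tmul (g : N ≃ₗ[ℤ] N) (a : ℚ) (x : N) : extQ g (a ⊗ₜ[ℤ] x) = a ⊗ₜ[ℤ] g x := rfl

theorem extQ_toNQ (g : N ≃ₗ[ℤ] N) (x : N) : extQ g (toNQ x) = toNQ (g x) := rfl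

theorem extQ_mul (g h : N ≃ₗ[ℤ] N) : extQ (g * h) = extQ g * extQ h :=
  LinearEquiv.baseChange_mul ℤ ℚ N g h

theorem extQ_one : extQ 1 = 1 := LinearEquiv.baseChange_one ℤ ℚ N

theorem formQ_extQ {g : N ≃ₗ[ℤ] N} (hg : g ∈ orthogonalGroup) (x y : NQ) :
    formQ (extQ g x) (extQ g y) = formQ x y := by
  induction x using TensorProduct.induction_on with
  | zero => simp
  | add x₁ x₂ h₁ h₂ => simp only [map_add, LinearMap.add_apply, h₁, h₂]
  | tmul a m =>
    induction y using TensorProduct.induction_on with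
    | zero => simp
    | add y₁ y₂ h₁ h₂ => simp only [map_add, h₁, h₂]
    | tmul b n => rw [extQ_tmul, extQ_tmul, formQ_tmul, formQ_tmul, hg]

theorem extQ_mem_dualN {g : N ≃ₗ[ℤ] N} (hg : g ∈ orthogonalGroup) {x : NQ} (hx : x ∈ dualN) :
    extQ g x ∈ dualN := by
  intro y
  obtain ⟨n, hn⟩ := hx (g.symm y)
  refine ⟨n, ?_⟩
  rw [← hn, ← formQ_extQ hg x, extQ_toNQ, LinearEquiv.apply_symm_apply]

/-- The automorphism of `N*` induced by an isometry of `N`. -/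
def dualMap (g : orthogonalGroup) : dualN →ₗ[ℤ] dualN where
  toFun x := ⟨extQ g.1 x.1, extQ_mem_dualN g.2 x.2⟩
  map_add' x y := Subtype.ext (map_add (extQ g.1) x.1 y.1)
  map_smul' c x := Subtype.ext (map_zsmul (extQ g.1) c x.1)

/-- The endomorphism of `A_N = N* / N` induced by an isometry of `N`. -/
def discMap (g : orthogonalGroup) : AN →ₗ[ℤ] AN :=
  NinDual.mapQ NinDual (dualMap g) (by
    rintro x ⟨n, hn⟩
    exact ⟨g.1 n, by rw [← extQ_toNQ, hn]; rfl⟩)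

theorem discMap_mk (g : orthogonalGroup) (x : dualN) :
    discMap g (NinDual.mkQ x) = NinDual.mkQ (dualMap g x) := rfl

theorem discMap_mul (g h : orthogonalGroup) (a : AN) :
    discMap (g * h) a = discMap g (discMap h a) := by
  obtain ⟨x, rfl⟩ := NinDual.mkQ_surjective a
  simp only [discMap_mk]
  congr 1
  exact Subtype.ext (by simp [dualMap, extQ_mul])

theorem discMap_one (a : AN) : discMap 1 a = a := by
  obtain ⟨x, rfl⟩ := NinDual.mkQ_surjective a
  simp only [discMap_mk]
  congr 1
  exact Subtype.ext (by simp [dualMap, extQ_one])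

/-- The natural homomorphism `O(N) → O(q_N)`. -/
def discHom : orthogonalGroup →* Oq where
  toFun g := ⟨LinearEquiv.ofLinearMap (discMap g) (discMap g⁻¹)
      (LinearMap.ext fun a => by
        simp only [LinearMap.comp_apply, ← discMap_mul, mul_inv_cancel, discMap_one,
          LinearMap.id_apply])
      (LinearMap.ext fun a => by
        simp only [LinearMap.comp_apply, ← discMap_mul, inv_mul_cancel, discMap_one,
          LinearMap.id_apply]),
    fun a => by
      obtain ⟨x, rfl⟩ := NinDual.mkQ_surjective a
      have h : ((formQ (extQ g.1 x.1) (extQ g.1 x.1) : ℚ) : ℚ ⧸ AddSubgroup.zmultiples (2 : ℚ))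
          = ((formQ x.1 x.1 : ℚ) : ℚ ⧸ AddSubgroup.zmultiples (2 : ℚ)) := by
        rw [formQ_extQ g.2]
      exact h⟩
  map_one' := Subtype.ext (LinearEquiv.ext discMap_one)
  map_mul' g h := Subtype.ext (LinearEquiv.ext (discMap_mul g h))

/-- The natural homomorphism `Γ → O(q_N)`. -/
def GamToOq : Gam →* Oq := discHom.comp (Subgroup.inclusion Gam_le)

/-- The group `Γ(1 - i) = Ker (Γ → O(q_N))`. -/
abbrev GamOneSubI : Subgroup Gam := GamToOq.ker

/-- `(x + ρ(x)) / 2` as an element of `N ⊗ ℚ`. -/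
def phiQ (x : N) : NQ := (1 / 2 : ℚ) ⊗ₜ[ℤ] (x + rho x)

theorem phiQ_mem (x : N) : phiQ x ∈ dualN := by
  intro y
  obtain ⟨n, hn⟩ := form_add_rho_even x y
  refine ⟨n, (formQ_tmul _ _ _ _).trans ?_⟩
  rw [hn]
  push_cast
  ring

/-- The class of `(x + ρ(x)) / 2 ∈ N*` in `A_N`. -/
def phi (x : N) : AN := NinDual.mkQ ⟨phiQ x, phiQ_mem x⟩

/-! ### `ρ`-invariant sublattices `A₁ ⊕ A₁` -/

/-- The form of the negative definite lattice `A₁ ⊕ A₁` on `ℤ²`. -/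
def formA1A1 (s t : ℤ × ℤ) : ℤ := -2 * (s.1 * t.1) - 2 * (s.2 * t.2)

/-- `R` is `ρ`-invariant and isometric to `A₁ ⊕ A₁`. -/
def IsRhoA1A1 (R : Submodule ℤ N) : Prop :=
  R.map rho = R ∧ ∃ e : (ℤ × ℤ) ≃ₗ[ℤ] R, ∀ s t, form (e s) (e t) = formA1A1 s t

/-- The set of `ρ`-invariant sublattices `R ≅ A₁ ⊕ A₁` of `N`. -/
def RhoA1A1 : Type := {R : Submodule ℤ N // IsRhoA1A1 R}

theorem IsRhoA1A1.map {R : Submodule ℤ N} (hR : IsRhoA1A1 R) (g : Gam) :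
    IsRhoA1A1 (R.map (g.1 : N →ₗ[ℤ] N)) := by
  obtain ⟨h1, e, he⟩ := hR
  refine ⟨?_, e.trans (g.1.submoduleMap R), fun s t => ?_⟩
  · have hc : rho.comp (g.1 : N →ₗ[ℤ] N) = (g.1 : N →ₗ[ℤ] N).comp rho :=
      LinearMap.ext fun x => (g.2.2 x).symm
    rw [← Submodule.map_comp, hc, Submodule.map_comp, h1]
  · exact (g.2.1 _ _).trans (he s t)

/-- `Γ` acts on the sublattices by taking images. -/
instance : MulAction Gam RhoA1A1 where
  smul g R := ⟨R.1.map (g.1 : N →ₗ[ℤ] N), R.2.map g⟩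
  one_smul R := Subtype.ext (Submodule.map_id R.1)
  mul_smul g h R := Subtype.ext (Submodule.map_comp (h.1 : N →ₗ[ℤ] N) (g.1 : N →ₗ[ℤ] N) R.1)

/-! ### Cusps of the complex ball -/

/-- `N ⊗ ℂ`. -/
abbrev NC : Type := ℂ ⊗[ℤ] N

/-- The complex bilinear extension of the form of `N`. -/
def formC : LinearMap.BilinForm ℂ NC := form.baseChange ℂ

/-- The complex linear extension of `ρ`. -/
def rhoC : NC →ₗ[ℂ] NC := rho.baseChange ℂ

/-- Complex conjugation `z ↦ z̄` of `N ⊗ ℂ`. -/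
def conjC : NC →ₗ[ℤ] NC :=
  TensorProduct.map (starRingEnd ℂ).toAddMonoidHom.toIntLinearMap LinearMap.id

theorem formC_tmul (a b : ℂ) (x y : N) : formC (a ⊗ₜ[ℤ] x) (b ⊗ₜ[ℤ] y) = form x y * (a * b) := by
  rw [← zsmul_eq_mul]
  exact LinearMap.BilinForm.baseChange_tmul (A := ℂ) form a x b y

theorem rhoC_tmul (a : ℂ) (x : N) : rhoC (a ⊗ₜ[ℤ] x) = a ⊗ₜ[ℤ] rho x := rfl

theorem conjC_tmul (a : ℂ) (x : N) :
    conjC (a ⊗ₜ[ℤ] x) = (starRingEnd ℂ a) ⊗ₜ[ℤ] x := rfl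

/-- The eigenspace `V₊ = {z ∈ N ⊗ ℂ | ρ(z) = √-1 z}`. -/
def Vplus : Submodule ℂ NC := LinearMap.ker (rhoC - Complex.I • LinearMap.id)

/-- The complex ball `𝓑 = {z ∈ ℙ(V₊) | ⟨z, z̄⟩ > 0}`, as a subset of `ℙ(N ⊗ ℂ)`. -/
def ball : Set (ℙ ℂ NC) :=
  {p | p.submodule ≤ Vplus ∧ ∀ z ∈ p.submodule, z ≠ 0 → 0 < (formC z (conjC z)).re}

/-- The boundary `{z ∈ ℙ(V₊) | ⟨z, z̄⟩ = 0}` of the ball in `ℙ(V₊)`. -/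
def ballBoundary : Set (ℙ ℂ NC) :=
  {p | p.submodule ≤ Vplus ∧ ∀ z ∈ p.submodule, formC z (conjC z) = 0}

/-- The vector `a + √-1 b` of `N ⊗ ℤ[√-1] ⊆ N ⊗ ℂ`. -/
def gaussVec (a b : N) : NC := (1 : ℂ) ⊗ₜ[ℤ] a + Complex.I ⊗ₜ[ℤ] b

/-- A point of `ℙ(N ⊗ ℂ)` is rational over `ℚ(√-1)` if it is spanned by a vector of
`N ⊗ ℚ(√-1)`; clearing denominators, by a vector of `N ⊗ ℤ[√-1]`. -/
def IsGaussRational (p : ℙ ℂ NC) : Prop :=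
  ∃ a b : N, p.submodule = Submodule.span ℂ {gaussVec a b}

/-- The cusps of `𝓑`: the `ℚ(√-1)`-rational points of the boundary of `𝓑` in `ℙ(V₊)`
(equivalently, the rational boundary components of `𝓑`). -/
def Cusp : Type := {p : ℙ ℂ NC // p ∈ ballBoundary ∧ IsGaussRational p}

/-- The extension of an automorphism of `N` to `N ⊗ ℂ`. -/
def extC (g : N ≃ₗ[ℤ] N) : NC ≃ₗ[ℂ] NC := g.baseChange ℤ ℂ N N

theorem extC_tmul (g : N ≃ₗ[ℤ] N) (a : ℂ) (x : N) : extC g (a ⊗ₜ[ℤ] x) = a ⊗ₜ[ℤ] g x := rfl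

theorem extC_mul (g h : N ≃ₗ[ℤ] N) : extC (g * h) = extC g * extC h :=
  LinearEquiv.baseChange_mul ℤ ℂ N g h

theorem extC_one : extC 1 = 1 := LinearEquiv.baseChange_one ℤ ℂ N

theorem formC_extC {g : N ≃ₗ[ℤ] N} (hg : g ∈ orthogonalGroup) (x y : NC) :
    formC (extC g x) (extC g y) = formC x y := by
  induction x using TensorProduct.induction_on with
  | zero => simp
  | add x₁ x₂ h₁ h₂ => simp only [map_add, LinearMap.add_apply, h₁, h₂]
  | tmul a m =>
    induction y using TensorProduct.induction_on with
    | zero => simp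
    | add y₁ y₂ h₁ h₂ => simp only [map_add, h₁, h₂]
    | tmul b n => rw [extC_tmul, extC_tmul, formC_tmul, formC_tmul, hg]

theorem conjC_extC (g : N ≃ₗ[ℤ] N) (x : NC) : conjC (extC g x) = extC g (conjC x) := by
  induction x using TensorProduct.induction_on with
  | zero => simp
  | add x₁ x₂ h₁ h₂ => simp only [map_add, h₁, h₂]
  | tmul a m => rfl

theorem rhoC_extC (g : Gam) (x : NC) : rhoC (extC g.1 x) = extC g.1 (rhoC x) := by
  induction x using TensorProduct.induction_on with
  | zero => simp
  | add x₁ x₂ h₁ h₂ => simp only [map_add, h₁, h₂]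
  | tmul a m => rw [rhoC_tmul, extC_tmul, extC_tmul, rhoC_tmul, g.2.2]

theorem mem_Vplus (z : NC) : z ∈ Vplus ↔ rhoC z = Complex.I • z := by
  simp [Vplus, sub_eq_zero]

theorem submodule_smul (f : NC ≃ₗ[ℂ] NC) (p : ℙ ℂ NC) :
    (f • p).submodule = p.submodule.map (f : NC →ₗ[ℂ] NC) := by
  induction p with
  | h v hv =>
    rw [Projectivization.smul_mk, Projectivization.submodule_mk, Projectivization.submodule_mk,
      Submodule.map_span, Set.image_singleton]
    rfl

theorem cusp_smul (g : Gam) {p : ℙ ℂ NC} (hp : p ∈ ballBoundary ∧ IsGaussRational p) :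
    extC g.1 • p ∈ ballBoundary ∧ IsGaussRational (extC g.1 • p) := by
  obtain ⟨⟨h1, h2⟩, a, b, h3⟩ := hp
  refine ⟨⟨?_, ?_⟩, g.1 a, g.1 b, ?_⟩
  · rw [submodule_smul]
    rintro _ ⟨z, hz, rfl⟩
    have h := (mem_Vplus z).1 (h1 hz)
    refine (mem_Vplus _).2 ((rhoC_extC g z).trans ?_)
    rw [h, map_smul]
    rfl
  · rw [submodule_smul]
    rintro _ ⟨z, hz, rfl⟩
    refine Eq.trans ?_ (h2 z hz)
    refine Eq.trans ?_ (formC_extC g.2.1 z (conjC z))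
    rw [← conjC_extC]
    rfl
  · rw [submodule_smul, h3, Submodule.map_span, Set.image_singleton]
    congr 2

/-- The action of `Γ` on the cusps, induced by the linear action of `Γ` on `N ⊗ ℂ`. -/
instance : MulAction Gam Cusp where
  smul g c := ⟨extC g.1 • c.1, cusp_smul g c.2⟩
  one_smul c := Subtype.ext (by
    change extC 1 • c.1 = c.1
    rw [extC_one, one_smul])
  mul_smul g h c := Subtype.ext (by
    change extC (g.1 * h.1) • c.1 = extC g.1 • extC h.1 • c.1
    rw [extC_mul, mul_smul])

/-- The `ρ`-invariant isotropic sublattice of `N` that corresponds to a cusp: the vectors `x ∈ N`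
whose component `x - √-1 ρ(x)` (up to a factor 2) in `V₊` lies on the line of the cusp. -/
def Cusp.lattice (c : Cusp) : Submodule ℤ N where
  carrier := {x | gaussVec x (-rho x) ∈ c.1.submodule}
  add_mem' := by
    intro x y hx hy
    have e : gaussVec (x + y) (-rho (x + y)) = gaussVec x (-rho x) + gaussVec y (-rho y) := by
      simp only [gaussVec, map_add, neg_add, TensorProduct.tmul_add]
      abel
    change gaussVec (x + y) (-rho (x + y)) ∈ c.1.submodule
    rw [e]
    exact add_mem hx hy
  zero_mem' := by simp [gaussVec]
  smul_mem' := by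
    intro n x hx
    have e : gaussVec (n • x) (-rho (n • x)) = n • gaussVec x (-rho x) := by
      simp only [gaussVec, map_smul, ← smul_neg, TensorProduct.tmul_smul, smul_add]
    change gaussVec (n • x) (-rho (n • x)) ∈ c.1.submodule
    rw [e]
    exact zsmul_mem hx n

end EightPoints

end

open EightPoints

noncomputable section

namespace EightPoints

/-! ### A Gaussian model of the lattice -/

/-! In suitable coordinates `ρ` is multiplication by `i`, and `N` is the free `ℤ[i]`-module `M` of
rank 6. Its form is the real part of `(1 + i) * herm`, where the sesquilinear form `herm` is
unimodular. Hence `N* = (1 + i)/2 · N`, and `phi`, which is division by `1 - i`, identifies `A_N`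
with `M / (1 - i)M = F = 𝔽₂⁶` (`discEquiv`). Under it `q_N` becomes `halfNorm` modulo 2, that is
`quad`.

`F` is also the space of even subsets of an eight-element set modulo complements, with half the
cardinality as quadratic form. The 28 non-isotropic vectors are the pairs of points, and the 35
non-zero isotropic vectors are the splittings into two blocks of four. Two pairs have product 1
exactly when they share one point; so an isometry preserves incidence of pairs and comes from a
permutation (`exists_perm`), and `O(q_N)` embeds in `S₈`. A vector `r` with `⟨r, r⟩ = -2` defines a
reflection `r ↦ i r` in `Γ` which reduces to the transvection in the class of `r`, and this is a
transposition. Every pair lifts to such an `r`, so `Γ` maps onto `S₈`, which is (i).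

Transitivity in (ii) is a Euclidean algorithm on the first coordinate `a`. Eichler transvections
move the two `D₄` components by `a • D₄`, and the covering radius of `D₄` makes them so short that
exchanging the two hyperbolic coordinates lowers `|a|`. Only for isotropic vectors can equality
occur, at a deep hole of `D₄`, and one more transvection in a root resolves it
(`exists_descent_isotropic`, `exists_descent_root`).

For (iii), the class in `A_N` is an equivariant map on a transitive `Γ`-set. Its values classify the
orbits of the kernel as soon as the stabilizer of a base point has the same image in `S₈` as the
stabilizer of its class (`exists_orbit_equiv`). The latter are `S₂ × S₆` for a pair and `S₄ ≀ S₂`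
for a splitting. Their transpositions come from reflections in roots that are orthogonal to the base
vector or equal to it, and the exchange of the blocks comes from the exchange of the two `D₄`. -/

/-- `ℤ[i]⁶`, with coordinates `((a, b), (p, q), (r, s))`: the pair `(a, b)` describes `U ⊕ U(2)`
and the pairs `(p, q)`, `(r, s)` the two copies of `D₄`. -/
abbrev M : Type := (GaussianInt × GaussianInt) × (GaussianInt × GaussianInt) ×
  (GaussianInt × GaussianInt)

/-- The imaginary unit of `ℤ[i]`. -/
def gi : GaussianInt := ⟨0, 1⟩

/-- Half the norm of the vector of `D₄` with coordinates `(p, q)`. -/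
def halfNormD4 (x : GaussianInt × GaussianInt) : ℤ :=
  x.1.re ^ 2 + x.1.im ^ 2 + x.2.re ^ 2 + x.2.im ^ 2
    + (x.2.re * x.1.re + x.2.im * x.1.im - x.2.im * x.1.re + x.2.re * x.1.im)

/-- Half the norm of a vector of the model. -/
def halfNorm (v : M) : ℤ :=
  (v.1.1.re * v.1.2.re + v.1.1.im * v.1.2.im - v.1.1.im * v.1.2.re + v.1.1.re * v.1.2.im)
    - halfNormD4 v.2.1 - halfNormD4 v.2.2

/-- The map from the model of `U ⊕ U(2)` to its basis coordinates. -/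
def hypToN : (GaussianInt × GaussianInt) →ₗ[ℤ] (Fin 4 → ℤ) where
  toFun x := ![x.1.re - x.1.im, x.2.re + x.2.im, -x.1.im, -x.2.im]
  map_add' x y := by ext i; fin_cases i <;> simp <;> ring
  map_smul' c x := by ext i; fin_cases i <;> simp <;> ring

/-- The map from the model of `D₄` to its standard coordinates. -/
def d4ToN : (GaussianInt × GaussianInt) →ₗ[ℤ] D4 where
  toFun x := ⟨![x.1.re, -x.1.im, x.1.re + x.2.re - x.2.im, -(x.1.im + x.2.re + x.2.im)],
    ⟨x.1.re - x.1.im - x.2.im, by simp; ring⟩⟩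
  map_add' x y := by ext i; fin_cases i <;> simp <;> ring
  map_smul' c x := by ext i; fin_cases i <;> simp <;> ring

theorem hypToN_bijective : Function.Bijective hypToN := by
  constructor
  · intro x y h
    have h0 := congrFun h 0
    have h1 := congrFun h 1
    have h2 := congrFun h 2
    have h3 := congrFun h 3
    simp [hypToN] at h0 h1 h2 h3
    refine Prod.ext (Zsqrtd.ext ?_ ?_) (Zsqrtd.ext ?_ ?_) <;> linarith
  · intro x
    refine ⟨(⟨x 0 - x 2, -x 2⟩, ⟨x 1 + x 3, -x 3⟩), ?_⟩
    ext i; fin_cases i <;> simp [hypToN]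

theorem d4ToN_bijective : Function.Bijective d4ToN := by
  constructor
  · intro x y h
    have h0 := congrFun (congrArg Subtype.val h) 0
    have h1 := congrFun (congrArg Subtype.val h) 1
    have h2 := congrFun (congrArg Subtype.val h) 2
    have h3 := congrFun (congrArg Subtype.val h) 3
    simp [d4ToN] at h0 h1 h2 h3
    refine Prod.ext (Zsqrtd.ext ?_ ?_) (Zsqrtd.ext ?_ ?_) <;> linarith
  · intro x
    obtain ⟨k, hk⟩ := x.2
    -- Solving for the second coordinate requires a division by `1 + i`; it is possible because the
    -- coordinate sum is the even number `k + k`.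
    refine ⟨(⟨x.1 0, -x.1 1⟩, ⟨x.1 1 + x.1 2 - k, x.1 0 + x.1 1 - k⟩), ?_⟩
    ext i; fin_cases i <;> simp [d4ToN] <;> linarith

/-- The identification of the model with `N`. -/
def modelEquiv : M ≃ₗ[ℤ] N :=
  (LinearEquiv.ofBijective hypToN hypToN_bijective).prodCongr
    ((LinearEquiv.ofBijective d4ToN d4ToN_bijective).prodCongr
      (LinearEquiv.ofBijective d4ToN d4ToN_bijective))

theorem modelEquiv_apply (v : M) :
    modelEquiv v = (hypToN v.1, d4ToN v.2.1, d4ToN v.2.2) := rfl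

/-- This is what the coordinates are chosen for: elements of `Γ` become `ℤ[i]`-linear isometries of
`M`. -/
theorem rho_modelEquiv (v : M) : rho (modelEquiv v) = modelEquiv (gi • v) := by
  refine Prod.ext ?_ (Prod.ext ?_ ?_)
  · ext i; fin_cases i <;> simp [modelEquiv_apply, rho, rhoOne, hypToN, gi] <;> ring
  · ext i; fin_cases i <;> simp [modelEquiv_apply, rho, rhoZero, d4ToN, gi] <;> ring
  · ext i; fin_cases i <;> simp [modelEquiv_apply, rho, rhoZero, d4ToN, gi] <;> ring

theorem form_modelEquiv_self (v : M) : form (modelEquiv v) (modelEquiv v) = 2 * halfNorm v := by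
  simp [modelEquiv_apply, form, hypToN, d4ToN, halfNorm, halfNormD4, Fin.sum_univ_four]
  ring

/-- The polar form of a pair of vectors of the model. -/
def polar (v w : M) : ℤ := halfNorm (v + w) - halfNorm v - halfNorm w

theorem form_modelEquiv (v w : M) : form (modelEquiv v) (modelEquiv w) = polar v w := by
  have h := form_modelEquiv_self (v + w)
  rw [map_add] at h
  simp only [map_add, LinearMap.add_apply, form_modelEquiv_self,
    form_comm (modelEquiv w) (modelEquiv v)] at h
  rw [polar]
  linarith

/-- The `ℤ[i]`-linear isometries of the model. -/
def U : Subgroup (M ≃ₗ[GaussianInt] M) where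
  carrier := {g | ∀ v, halfNorm (g v) = halfNorm v}
  mul_mem' := by
    intro g h hg hh v
    rw [LinearEquiv.mul_apply, hg, hh]
  one_mem' := fun _ => rfl
  inv_mem' := by
    intro g hg v
    have h := hg (g⁻¹ v)
    simpa only [← LinearEquiv.mul_apply, mul_inv_cancel, LinearEquiv.coe_one, id_eq] using h.symm

theorem gaussian_smul_eq (c : GaussianInt) (v : M) : c • v = c.re • v + c.im • (gi • v) := by
  refine Prod.ext (Prod.ext ?_ ?_) (Prod.ext (Prod.ext ?_ ?_) (Prod.ext ?_ ?_)) <;>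
    ext <;> simp [gi]

/-- The element of `Γ` given by a `ℤ[i]`-linear isometry of the model. -/
def toGam (g : U) : Gam :=
  ⟨modelEquiv.symm.trans ((g.1.restrictScalars ℤ).trans modelEquiv), by
    constructor
    · intro x y
      obtain ⟨v, rfl⟩ := modelEquiv.surjective x
      obtain ⟨w, rfl⟩ := modelEquiv.surjective y
      simp only [LinearEquiv.trans_apply, LinearEquiv.symm_apply_apply, form_modelEquiv,
        LinearEquiv.restrictScalars_apply, polar, ← map_add, g.2 _]
    · intro x
      obtain ⟨v, rfl⟩ := modelEquiv.surjective x
      simp only [rho_modelEquiv, LinearEquiv.trans_apply, LinearEquiv.symm_apply_apply,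
        LinearEquiv.restrictScalars_apply, map_smul]⟩

theorem toGam_modelEquiv (g : U) (v : M) : (toGam g).1 (modelEquiv v) = modelEquiv (g.1 v) := by
  simp [toGam]

/-- An isometry of the model, from a linear map with a left and right inverse. -/
def mkU (f g : M →ₗ[GaussianInt] M) (hfg : ∀ v, f (g v) = v) (hgf : ∀ v, g (f v) = v)
    (hf : ∀ v, halfNorm (f v) = halfNorm v) : U :=
  ⟨LinearEquiv.ofLinearMap f g (LinearMap.ext hfg) (LinearMap.ext hgf), hf⟩

/-! ### The Hermitian form and explicit isometries -/

/-- The Hermitian form of the model, divided by `1 + i`. -/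
def herm (v w : M) : GaussianInt :=
  v.1.1 * star w.1.2 - gi * v.1.2 * star w.1.1
    - ((1 - gi) * v.2.1.1 * star w.2.1.1 - gi * v.2.1.1 * star w.2.1.2
      + v.2.1.2 * star w.2.1.1 + (1 - gi) * v.2.1.2 * star w.2.1.2)
    - ((1 - gi) * v.2.2.1 * star w.2.2.1 - gi * v.2.2.1 * star w.2.2.2
      + v.2.2.2 * star w.2.2.1 + (1 - gi) * v.2.2.2 * star w.2.2.2)

/-- `herm` as a linear map in the first argument. -/
def hermLin (w : M) : M →ₗ[GaussianInt] GaussianInt where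
  toFun v := herm v w
  map_add' v v' := by simp only [herm, Prod.fst_add, Prod.snd_add]; ring
  map_smul' c v := by
    simp only [herm, Prod.smul_fst, Prod.smul_snd, smul_eq_mul, RingHom.id_apply]; ring

/-- With `H = (1 + i) * herm`, the linear term is the real part of `star c * H v r`; thus `herm`
carries all the information of the polar form. -/
theorem halfNorm_add_smul (v r : M) (c : GaussianInt) :
    halfNorm (v + c • r) = halfNorm v + (c.re * ((herm v r).re - (herm v r).im)
      + c.im * ((herm v r).re + (herm v r).im)) + (c.re ^ 2 + c.im ^ 2) * halfNorm r := by
  simp [halfNorm, halfNormD4, herm, gi]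
  ring

theorem herm_self (r : M) : herm r r = ⟨halfNorm r, -halfNorm r⟩ := by
  ext <;> simp [halfNorm, halfNormD4, herm, gi] <;> ring

theorem hermLin_self {r : M} (hr : halfNorm r = -1) : hermLin r r = ⟨-1, 1⟩ := by
  change herm r r = _
  rw [herm_self]
  simp [hr]

/-- The reflection of order 4 in a vector of norm `-2`. -/
def reflection (r : M) (hr : halfNorm r = -1) : U :=
  -- Since `herm r r = -1 + i`, the first map sends `r` to `i r` and the second sends it to `(1 +
  -- i(-1 + i)) r = -i r`; both fix the orthogonal complement.
  mkU (LinearMap.id + (hermLin r).smulRight r) (LinearMap.id + gi • (hermLin r).smulRight r)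
    (by
      intro v
      change v + gi • hermLin r v • r + hermLin r (v + gi • hermLin r v • r) • r = v
      rw [map_add, map_smul, map_smul, hermLin_self hr, smul_smul, add_assoc, ← add_smul]
      convert add_zero v
      convert zero_smul GaussianInt r
      ext <;> simp [gi])
    (by
      intro v
      change v + hermLin r v • r + gi • hermLin r (v + hermLin r v • r) • r = v
      rw [map_add, map_smul, hermLin_self hr, smul_smul, add_assoc, ← add_smul]
      convert add_zero v
      convert zero_smul GaussianInt r
      ext <;> simp [gi])
    (by
      intro v
      change halfNorm (v + herm v r • r) = _
      rw [halfNorm_add_smul, hr]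
      ring)

theorem reflection_apply (r : M) (hr : halfNorm r = -1) (v : M) :
    (reflection r hr).1 v = v + herm v r • r := rfl

/-- Multiplication by `i`. -/
def unitI : U :=
  mkU (gi • LinearMap.id) (-gi • LinearMap.id)
    (by intro v; simp only [LinearMap.smul_apply, LinearMap.id_apply, smul_smul]
        convert one_smul GaussianInt v
        ext <;> simp [gi])
    (by intro v; simp only [LinearMap.smul_apply, LinearMap.id_apply, smul_smul]
        convert one_smul GaussianInt v
        ext <;> simp [gi])
    (by intro v; simp [halfNorm, halfNormD4, gi]; ring)

theorem unitI_apply (v : M) : unitI.1 v = gi • v := rfl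

/-- The isometry that exchanges the two isotropic basis vectors of `U ⊕ U(2)`. -/
def hypSwap : U :=
  mkU
    ((((-gi) • LinearMap.snd GaussianInt GaussianInt GaussianInt).prod
      (LinearMap.fst GaussianInt GaussianInt GaussianInt)).prodMap LinearMap.id)
    (((LinearMap.snd GaussianInt GaussianInt GaussianInt).prod
      (gi • LinearMap.fst GaussianInt GaussianInt GaussianInt)).prodMap LinearMap.id)
    (by intro v; ext <;> simp [gi])
    (by intro v; ext <;> simp [gi])
    (by intro v; simp [halfNorm, gi]; ring)

theorem hypSwap_apply (v : M) : hypSwap.1 v = ((-gi * v.1.2, v.1.1), v.2) := rfl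

/-- The isometry that exchanges the two copies of `D₄`. -/
def d4Swap : U :=
  mkU
    (LinearMap.id.prodMap ((LinearMap.snd GaussianInt _ _).prod (LinearMap.fst GaussianInt _ _)))
    (LinearMap.id.prodMap ((LinearMap.snd GaussianInt _ _).prod (LinearMap.fst GaussianInt _ _)))
    (by intro v; rfl) (by intro v; rfl)
    (by intro v; simp [halfNorm]; ring)

theorem d4Swap_apply (v : M) : d4Swap.1 v = (v.1, v.2.2, v.2.1) := rfl

/-- The Hermitian form of `D₄` divided by `1 - i`. -/
def lam (x y : GaussianInt × GaussianInt) : GaussianInt :=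
  (1 + gi) * x.1 * star y.1 + x.1 * star y.2 + gi * x.2 * star y.1 + (1 + gi) * x.2 * star y.2

/-- The linear map underlying an Eichler transvection. -/
def eichlerLin (y : (GaussianInt × GaussianInt) × (GaussianInt × GaussianInt)) (n : ℤ) :
    M →ₗ[GaussianInt] M where
  toFun v := ((v.1.1, v.1.2 + lam v.2.1 y.1 + lam v.2.2 y.2
      + v.1.1 * (⟨halfNormD4 y.1 + halfNormD4 y.2, 0⟩ + ⟨n, -n⟩)), v.2 + v.1.1 • y)
  map_add' v w := by
    refine Prod.ext (Prod.ext rfl ?_) ?_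
    · simp only [lam, Prod.fst_add, Prod.snd_add]; ring
    · simp only [Prod.fst_add, Prod.snd_add, add_smul]; abel
  map_smul' c v := by
    refine Prod.ext (Prod.ext rfl ?_) ?_
    · simp only [lam, Prod.smul_fst, Prod.smul_snd, smul_eq_mul, RingHom.id_apply]; ring
    · simp only [Prod.smul_fst, Prod.smul_snd, smul_eq_mul, RingHom.id_apply, smul_add, mul_smul]

theorem halfNormD4_neg (y : GaussianInt × GaussianInt) : halfNormD4 (-y) = halfNormD4 y := by
  simp [halfNormD4]

theorem lam_self (y : GaussianInt × GaussianInt) :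
    lam y y = ⟨halfNormD4 y, halfNormD4 y⟩ := by
  ext <;> simp [lam, halfNormD4, gi] <;> ring

theorem lam_neg_right (x y : GaussianInt × GaussianInt) : lam x (-y) = -lam x y := by
  simp only [lam, Prod.fst_neg, Prod.snd_neg, star_neg]; ring

theorem lam_add_smul_left (x x' y : GaussianInt × GaussianInt) (c : GaussianInt) :
    lam (x + c • x') y = lam x y + c * lam x' y := by
  simp only [lam, Prod.fst_add, Prod.snd_add, Prod.smul_fst, Prod.smul_snd, smul_eq_mul]; ring

/-- In the second coordinate the composite adds `(1 - i)(n + n' + h)` times the first one, `h` being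
the total half-norm of `y`, because `lam y y = (1 + i) * halfNormD4 y` in each component. The
hypothesis makes this vanish. -/
theorem eichlerLin_neg (y : (GaussianInt × GaussianInt) × (GaussianInt × GaussianInt))
    (n n' : ℤ) (h : n + n' + halfNormD4 y.1 + halfNormD4 y.2 = 0) (v : M) :
    eichlerLin (-y) n' (eichlerLin y n v) = v := by
  refine Prod.ext (Prod.ext rfl ?_) ?_
  · simp only [eichlerLin, LinearMap.coe_mk, AddHom.coe_mk, Prod.fst_add, Prod.snd_add,
      Prod.smul_fst, Prod.smul_snd, Prod.fst_neg, Prod.snd_neg, lam_neg_right, lam_add_smul_left,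
      lam_self, halfNormD4_neg]
    obtain rfl : n' = -n - halfNormD4 y.1 - halfNormD4 y.2 := by linarith
    ext <;> simp <;> ring
  · simp [eichlerLin]

theorem halfNorm_eichlerLin (y : (GaussianInt × GaussianInt) × (GaussianInt × GaussianInt))
    (n : ℤ) (v : M) : halfNorm (eichlerLin y n v) = halfNorm v := by
  simp [halfNorm, halfNormD4, eichlerLin, lam, gi]
  ring

/-- The Eichler transvection attached to the isotropic vector `((0, 1), 0, 0)`. -/
def eichler (y : (GaussianInt × GaussianInt) × (GaussianInt × GaussianInt)) (n : ℤ) : U :=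
  mkU (eichlerLin y n) (eichlerLin (-y) (-n - halfNormD4 y.1 - halfNormD4 y.2))
    (by
      intro v
      have h := eichlerLin_neg (-y) (-n - halfNormD4 y.1 - halfNormD4 y.2) n
        (by rw [Prod.fst_neg, Prod.snd_neg, halfNormD4_neg, halfNormD4_neg]; ring) v
      rwa [neg_neg] at h)
    (eichlerLin_neg y _ _ (by ring))
    (halfNorm_eichlerLin y n)

theorem eichler_apply (y : (GaussianInt × GaussianInt) × (GaussianInt × GaussianInt)) (n : ℤ)
    (v : M) : (eichler y n).1 v = ((v.1.1, v.1.2 + lam v.2.1 y.1 + lam v.2.2 y.2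
      + v.1.1 * (⟨halfNormD4 y.1 + halfNormD4 y.2, 0⟩ + ⟨n, -n⟩)), v.2 + v.1.1 • y) := rfl

/-! ### Rounding to the lattice `D₄` -/

theorem exists_rounding (t A : ℤ) (hA : 0 < A) :
    ∃ y d : ℤ, t = d + A * y ∧ -A < 2 * d ∧ 2 * d ≤ A := by
  have h1 := Int.emod_nonneg (A - 1 + 2 * t) (show 2 * A ≠ 0 by omega)
  have h2 := Int.emod_lt_of_pos (A - 1 + 2 * t) (show 0 < 2 * A by omega)
  have h3 := Int.emod_add_mul_ediv (A - 1 + 2 * t) (2 * A)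
  -- Rounding `t / A` to the nearest integer, with ties rounded down: this puts the value `2 * d =
  -- A` inside the interval and `-A` outside.
  refine ⟨(A - 1 + 2 * t) / (2 * A), t - A * ((A - 1 + 2 * t) / (2 * A)), by ring, ?_, ?_⟩ <;>
    linarith

/-- Repairs an odd coordinate sum by moving the entry farthest from zero to the other side. If `c =
|d₁|`, the new squared length is at most `4c² - 2Ac + A² = A² - 2c(A - 2c)`. Equality forces `c = A
/ 2` with all entries of equal size, or `c = 0` with all entries zero before the shift. -/
theorem exists_parity_correction {A d₁ d₂ d₃ d₄ : ℤ} (hA : 0 < A) (h₁ : -A ≤ 2 * d₁)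
    (h₁' : 2 * d₁ ≤ A) (h₂ : d₂ ^ 2 ≤ d₁ ^ 2) (h₃ : d₃ ^ 2 ≤ d₁ ^ 2) (h₄ : d₄ ^ 2 ≤ d₁ ^ 2) :
    ∃ s : ℤ, (s = 1 ∨ s = -1) ∧
      ((d₁ - A * s) ^ 2 + d₂ ^ 2 + d₃ ^ 2 + d₄ ^ 2 < A ^ 2 ∨
      (d₁ - A * s) ^ 2 + d₂ ^ 2 + d₃ ^ 2 + d₄ ^ 2 = A ^ 2 ∧
        (4 * (d₁ - A * s) ^ 2 = A ^ 2 ∧ 4 * d₂ ^ 2 = A ^ 2 ∧ 4 * d₃ ^ 2 = A ^ 2 ∧ 4 * d₄ ^ 2 = A ^ 2 ∨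
        (d₁ - A * s) ^ 2 = A ^ 2 ∧ d₂ = 0 ∧ d₃ = 0 ∧ d₄ = 0)) := by
  obtain ⟨s, hs, hs'⟩ : ∃ s : ℤ, (s = 1 ∨ s = -1) ∧ 0 ≤ d₁ * s := by
    rcases le_total 0 d₁ with h | h
    · exact ⟨1, Or.inl rfl, by linarith⟩
    · exact ⟨-1, Or.inr rfl, by linarith⟩
  refine ⟨s, hs, ?_⟩
  have hss : s ^ 2 = 1 := by rcases hs with rfl | rfl <;> norm_num
  have hle : 2 * (d₁ * s) ≤ A := by rcases hs with rfl | rfl <;> linarith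
  generalize hc : d₁ * s = c at *
  have hc2 : d₁ ^ 2 = c ^ 2 := by rw [← hc, mul_pow, hss, mul_one]
  have he : (d₁ - A * s) ^ 2 = c ^ 2 - 2 * A * c + A ^ 2 := by
    linear_combination A ^ 2 * hss - 2 * A * hc + hc2
  rw [he]
  rw [hc2] at h₂ h₃ h₄
  rcases lt_or_eq_of_le (show c ^ 2 - 2 * A * c + A ^ 2 + d₂ ^ 2 + d₃ ^ 2 + d₄ ^ 2 ≤ A ^ 2 by
    nlinarith) with h | h
  · exact Or.inl h
  · refine Or.inr ⟨h, ?_⟩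
    have h5 : c * (A - 2 * c) = 0 := le_antisymm (by nlinarith) (mul_nonneg hs' (by linarith))
    rcases mul_eq_zero.1 h5 with rfl | h6
    · right
      refine ⟨by ring, ?_, ?_, ?_⟩ <;> nlinarith
    · left
      obtain rfl : A = 2 * c := by linarith
      refine ⟨by ring, ?_, ?_, ?_⟩ <;> nlinarith

/-- Every integral vector is congruent modulo `A • D₄` to a vector of length at most `A`, and
vectors of length exactly `A` are needed only for the deep holes. -/
theorem exists_D4_rounding (t₁ t₂ t₃ t₄ A : ℤ) (hA : 0 < A) :
    ∃ y₁ y₂ y₃ y₄ d₁ d₂ d₃ d₄ : ℤ, t₁ = d₁ + A * y₁ ∧ t₂ = d₂ + A * y₂ ∧ t₃ = d₃ + A * y₃ ∧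
      t₄ = d₄ + A * y₄ ∧ Even (y₁ + y₂ + y₃ + y₄) ∧
      (d₁ ^ 2 + d₂ ^ 2 + d₃ ^ 2 + d₄ ^ 2 < A ^ 2 ∨ d₁ ^ 2 + d₂ ^ 2 + d₃ ^ 2 + d₄ ^ 2 = A ^ 2 ∧
        (4 * d₁ ^ 2 = A ^ 2 ∧ 4 * d₂ ^ 2 = A ^ 2 ∧ 4 * d₃ ^ 2 = A ^ 2 ∧ 4 * d₄ ^ 2 = A ^ 2 ∨
        d₁ ^ 2 = A ^ 2 ∧ d₂ = 0 ∧ d₃ = 0 ∧ d₄ = 0 ∨ d₂ ^ 2 = A ^ 2 ∧ d₁ = 0 ∧ d₃ = 0 ∧ d₄ = 0 ∨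
        d₃ ^ 2 = A ^ 2 ∧ d₁ = 0 ∧ d₂ = 0 ∧ d₄ = 0 ∨ d₄ ^ 2 = A ^ 2 ∧ d₁ = 0 ∧ d₂ = 0 ∧ d₃ = 0)) := by
  obtain ⟨y₁, d₁, e₁, l₁, u₁⟩ := exists_rounding t₁ A hA
  obtain ⟨y₂, d₂, e₂, l₂, u₂⟩ := exists_rounding t₂ A hA
  obtain ⟨y₃, d₃, e₃, l₃, u₃⟩ := exists_rounding t₃ A hA
  obtain ⟨y₄, d₄, e₄, l₄, u₄⟩ := exists_rounding t₄ A hA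
  have b₁ : 4 * d₁ ^ 2 ≤ A ^ 2 := by nlinarith
  have b₂ : 4 * d₂ ^ 2 ≤ A ^ 2 := by nlinarith
  have b₃ : 4 * d₃ ^ 2 ≤ A ^ 2 := by nlinarith
  have b₄ : 4 * d₄ ^ 2 ≤ A ^ 2 := by nlinarith
  rcases Int.even_or_odd (y₁ + y₂ + y₃ + y₄) with hev | hodd
  · refine ⟨y₁, y₂, y₃, y₄, d₁, d₂, d₃, d₄, e₁, e₂, e₃, e₄, hev, ?_⟩
    rcases lt_or_eq_of_le (show d₁ ^ 2 + d₂ ^ 2 + d₃ ^ 2 + d₄ ^ 2 ≤ A ^ 2 by linarith) with h | h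
    · exact Or.inl h
    · refine Or.inr ⟨h, Or.inl ⟨?_, ?_, ?_, ?_⟩⟩ <;> linarith
  · have hpar : ∀ s : ℤ, (s = 1 ∨ s = -1) → Even (y₁ + y₂ + y₃ + y₄ + s) := by
      rintro s (rfl | rfl)
      · exact hodd.add_odd odd_one
      · exact hodd.add_odd (by decide)
    have hmax : (d₂ ^ 2 ≤ d₁ ^ 2 ∧ d₃ ^ 2 ≤ d₁ ^ 2 ∧ d₄ ^ 2 ≤ d₁ ^ 2) ∨
        (d₁ ^ 2 ≤ d₂ ^ 2 ∧ d₃ ^ 2 ≤ d₂ ^ 2 ∧ d₄ ^ 2 ≤ d₂ ^ 2) ∨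
        (d₁ ^ 2 ≤ d₃ ^ 2 ∧ d₂ ^ 2 ≤ d₃ ^ 2 ∧ d₄ ^ 2 ≤ d₃ ^ 2) ∨
        (d₁ ^ 2 ≤ d₄ ^ 2 ∧ d₂ ^ 2 ≤ d₄ ^ 2 ∧ d₃ ^ 2 ≤ d₄ ^ 2) := by
      generalize d₁ ^ 2 = a, d₂ ^ 2 = b, d₃ ^ 2 = c, d₄ ^ 2 = d
      omega
    rcases hmax with ⟨h, h', h''⟩ | ⟨h, h', h''⟩ | ⟨h, h', h''⟩ | ⟨h, h', h''⟩
    · obtain ⟨s, hs, H⟩ := exists_parity_correction hA l₁.le u₁ h h' h''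
      refine ⟨y₁ + s, y₂, y₃, y₄, d₁ - A * s, d₂, d₃, d₄, by rw [e₁]; ring, e₂, e₃, e₄, ?_, ?_⟩
      · convert hpar s hs using 1; ring
      · rcases H with H | ⟨H, H' | H'⟩
        · exact Or.inl H
        · exact Or.inr ⟨H, Or.inl H'⟩
        · exact Or.inr ⟨H, Or.inr (Or.inl H')⟩
    · obtain ⟨s, hs, H⟩ := exists_parity_correction hA l₂.le u₂ h h' h''
      refine ⟨y₁, y₂ + s, y₃, y₄, d₁, d₂ - A * s, d₃, d₄, e₁, by rw [e₂]; ring, e₃, e₄, ?_, ?_⟩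
      · convert hpar s hs using 1; ring
      · rcases H with H | ⟨H, H' | H'⟩
        · exact Or.inl (by linarith)
        · exact Or.inr ⟨by linarith, Or.inl ⟨H'.2.1, H'.1, H'.2.2⟩⟩
        · exact Or.inr ⟨by linarith, Or.inr (Or.inr (Or.inl H'))⟩
    · obtain ⟨s, hs, H⟩ := exists_parity_correction hA l₃.le u₃ h h' h''
      refine ⟨y₁, y₂, y₃ + s, y₄, d₁, d₂, d₃ - A * s, d₄, e₁, e₂, by rw [e₃]; ring, e₄, ?_, ?_⟩
      · convert hpar s hs using 1; ring
      · rcases H with H | ⟨H, H' | H'⟩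
        · exact Or.inl (by linarith)
        · exact Or.inr ⟨by linarith, Or.inl ⟨H'.2.1, H'.2.2.1, H'.1, H'.2.2.2⟩⟩
        · exact Or.inr ⟨by linarith, Or.inr (Or.inr (Or.inr (Or.inl H')))⟩
    · obtain ⟨s, hs, H⟩ := exists_parity_correction hA l₄.le u₄ h h' h''
      refine ⟨y₁, y₂, y₃, y₄ + s, d₁, d₂, d₃, d₄ - A * s, e₁, e₂, e₃, by rw [e₄]; ring, ?_, ?_⟩
      · convert hpar s hs using 1; ring
      · rcases H with H | ⟨H, H' | H'⟩
        · exact Or.inl (by linarith)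
        · exact Or.inr ⟨by linarith, Or.inl ⟨H'.2.1, H'.2.2.1, H'.2.2.2, H'.1⟩⟩
        · exact Or.inr ⟨by linarith, Or.inr (Or.inr (Or.inr (Or.inr H')))⟩

/-! ### Deep holes of `D₄` in Gaussian coordinates -/

/-- The norm of a Gaussian integer. -/
def absSq (a : GaussianInt) : ℤ := a.re ^ 2 + a.im ^ 2

theorem absSq_nonneg (a : GaussianInt) : 0 ≤ absSq a := by unfold absSq; positivity

theorem absSq_eq_zero {a : GaussianInt} (h : absSq a = 0) : a = 0 := by
  unfold absSq at h
  ext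
  · exact pow_eq_zero_iff two_ne_zero |>.1 (le_antisymm (by nlinarith) (sq_nonneg a.re))
  · exact pow_eq_zero_iff two_ne_zero |>.1 (le_antisymm (by nlinarith) (sq_nonneg a.im))

theorem absSq_pos {a : GaussianInt} (h : a ≠ 0) : 0 < absSq a :=
  lt_of_le_of_ne (absSq_nonneg a) fun h' => h (absSq_eq_zero h'.symm)

theorem absSq_mul (a b : GaussianInt) : absSq (a * b) = absSq a * absSq b := by
  simp [absSq]; ring

theorem absSq_star (a : GaussianInt) : absSq (star a) = absSq a := by simp [absSq]

theorem mul_star_eq (a : GaussianInt) : a * star a = ⟨absSq a, 0⟩ := by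
  ext <;> simp [absSq] <;> ring

/-- Here `D₄` is seen as the pairs `(z, w)` of Gaussian integers congruent modulo `1 + i`, with `z =
x.1` and `w = x.1 + (1 + i) x.2`, and with norm `|z|² + |w|²`. -/
theorem two_mul_halfNormD4 (x : GaussianInt × GaussianInt) :
    2 * halfNormD4 x = absSq x.1 + absSq (x.1 + (1 + gi) * x.2) := by
  simp [halfNormD4, absSq, gi]; ring

theorem halfNormD4_nonneg (x : GaussianInt × GaussianInt) : 0 ≤ halfNormD4 x := by
  have := two_mul_halfNormD4 x
  have := absSq_nonneg x.1
  have := absSq_nonneg (x.1 + (1 + gi) * x.2)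
  omega

theorem halfNormD4_eq_zero {x : GaussianInt × GaussianInt} (h : halfNormD4 x = 0) : x = 0 := by
  have h1 := two_mul_halfNormD4 x
  have h2 := absSq_nonneg x.1
  have h3 := absSq_nonneg (x.1 + (1 + gi) * x.2)
  have h4 : x.1 = 0 := absSq_eq_zero (by omega)
  have h5 := absSq_eq_zero (show absSq (x.1 + (1 + gi) * x.2) = 0 by omega)
  rw [h4, zero_add] at h5
  refine Prod.ext h4 ((mul_eq_zero.1 h5).resolve_left ?_)
  intro h
  have := congrArg Zsqrtd.im h
  simp [gi] at this

/-- This and the next lemma evaluate `lam` against the two kinds of vectors used at deep holes, in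
terms of `z` and `w`; the factor `1 + i` avoids a division. -/
theorem lam_zero_left (x : GaussianInt × GaussianInt) (u : GaussianInt) :
    (1 + gi) * lam x (0, u) = (1 + gi) * (x.1 + (1 + gi) * x.2) * star u := by
  simp [lam]; ring

theorem lam_zero_right (x : GaussianInt × GaussianInt) (u : GaussianInt) :
    (1 + gi) * lam x (u, 0) = gi * (x.1 + (x.1 + (1 + gi) * x.2)) * star u := by
  ext <;> simp [lam, gi] <;> ring

/-- The covering radius of `D₄`, together with a description of the deep holes. -/
theorem exists_D4_reduction (a : GaussianInt) (ha : a ≠ 0) (x : GaussianInt × GaussianInt) :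
    ∃ y, 2 * halfNormD4 (x + a • y) < absSq a ∨ 2 * halfNormD4 (x + a • y) = absSq a ∧
      ∃ y', halfNormD4 y' = 1 ∧ (1 + gi) * lam (x + a • y) y' = -a := by
  have hA := absSq_pos ha
  have hsa : star a ≠ 0 := fun h => ha (star_eq_zero.1 h)
  -- Multiplying by `star a` turns translation by `a • D₄` into translation by `|a|² • D₄`, where
  -- integral rounding applies.
  obtain ⟨y₁, y₂, y₃, y₄, d₁, d₂, d₃, d₄, e₁, e₂, e₃, e₄, ⟨k, hk⟩, H⟩ :=
    exists_D4_rounding (x.1 * star a).re (x.1 * star a).im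
      ((x.1 + (1 + gi) * x.2) * star a).re ((x.1 + (1 + gi) * x.2) * star a).im (absSq a) hA
  -- The vector with `z = -(y₁ + i y₂)` and `w = -(y₃ + i y₄)`; its second coordinate `(w - z) / (1
  -- + i)` is integral because `y₁ + y₂ + y₃ + y₄ = k + k`.
  set y : GaussianInt × GaussianInt := (⟨-y₁, -y₂⟩, ⟨y₁ + y₂ - k, k - y₁ - y₄⟩) with hy
  set x' := x + a • y with hx'
  have hz : x'.1 * star a = ⟨d₁, d₂⟩ := by
    have : x'.1 * star a = x.1 * star a + (a * star a) * y.1 := by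
      rw [hx', Prod.fst_add, Prod.smul_fst, smul_eq_mul]; ring
    rw [this, mul_star_eq]
    ext
    · rw [Zsqrtd.re_add, e₁]; simp [hy]
    · rw [Zsqrtd.im_add, e₂]; simp [hy]
  have hw : (x'.1 + (1 + gi) * x'.2) * star a = ⟨d₃, d₄⟩ := by
    have : (x'.1 + (1 + gi) * x'.2) * star a = (x.1 + (1 + gi) * x.2) * star a
        + (a * star a) * (y.1 + (1 + gi) * y.2) := by
      rw [hx', Prod.fst_add, Prod.smul_fst, smul_eq_mul, Prod.snd_add, Prod.smul_snd,
        smul_eq_mul]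
      ring
    have hy' : y.1 + (1 + gi) * y.2 = ⟨-y₃, -y₄⟩ := by
      ext <;> simp [hy, gi] <;> linarith
    rw [this, mul_star_eq, hy']
    ext
    · rw [Zsqrtd.re_add, e₃]; simp
    · rw [Zsqrtd.im_add, e₄]; simp
  have hn : 2 * halfNormD4 x' * absSq a = d₁ ^ 2 + d₂ ^ 2 + d₃ ^ 2 + d₄ ^ 2 := by
    have h1 := absSq_mul x'.1 (star a)
    have h2 := absSq_mul (x'.1 + (1 + gi) * x'.2) (star a)
    rw [hz, absSq_star] at h1
    rw [hw, absSq_star] at h2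
    rw [two_mul_halfNormD4, add_mul, ← h1, ← h2]
    simp only [absSq]; ring
  refine ⟨y, ?_⟩
  rcases H with H | ⟨H, H'⟩
  · left
    rw [← hn, sq] at H
    exact lt_of_mul_lt_mul_right H hA.le
  · right
    rw [← hn, sq] at H
    refine ⟨mul_right_cancel₀ hA.ne' H, ?_⟩
    have half : ∀ u : GaussianInt, halfNormD4 (0, u) = 1 →
        (1 + gi) * ⟨d₃, d₄⟩ * star u = ⟨-absSq a, 0⟩ →
        ∃ y', halfNormD4 y' = 1 ∧ (1 + gi) * lam x' y' = -a := by
      intro u hu h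
      refine ⟨(0, u), hu, mul_right_cancel₀ hsa ?_⟩
      rw [lam_zero_left, neg_mul, mul_star_eq, mul_right_comm _ (star u), mul_assoc _ _ (star a),
        hw, h]
      ext <;> simp
    have full : ∀ u : GaussianInt, halfNormD4 (u, 0) = 1 →
        gi * ⟨d₁ + d₃, d₂ + d₄⟩ * star u = ⟨-absSq a, 0⟩ →
        ∃ y', halfNormD4 y' = 1 ∧ (1 + gi) * lam x' y' = -a := by
      intro u hu h
      refine ⟨(u, 0), hu, mul_right_cancel₀ hsa ?_⟩
      rw [lam_zero_right, neg_mul, mul_star_eq, mul_right_comm _ (star u), mul_assoc _ _ (star a),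
        add_mul _ _ (star a), hw, hz]
      refine Eq.trans ?_ (h.trans ?_)
      · congr 2
      · ext <;> simp
    -- When all entries are `±A / 2`, a root `(0, u)` works, with the unit `u` read off from the
    -- signs of `d₃` and `d₄`. When a single entry is `±A`, a root `(u, 0)` works.
    rcases H' with ⟨-, -, h₃, h₄⟩ | ⟨h, h1, h2, h3⟩ | ⟨h, h1, h2, h3⟩ | ⟨h, h1, h2, h3⟩ |
      ⟨h, h1, h2, h3⟩
    · have h₃' : (2 * d₃) ^ 2 = absSq a ^ 2 := by linarith
      have h₄' : (2 * d₄) ^ 2 = absSq a ^ 2 := by linarith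
      rcases sq_eq_sq_iff_eq_or_eq_neg.1 h₃' with g | g <;>
      rcases sq_eq_sq_iff_eq_or_eq_neg.1 h₄' with g' | g'
      · exact half ⟨0, -1⟩ (by simp [halfNormD4]) (by ext <;> simp [gi] <;> linarith)
      · exact half ⟨-1, 0⟩ (by simp [halfNormD4]) (by ext <;> simp [gi] <;> linarith)
      · exact half ⟨1, 0⟩ (by simp [halfNormD4]) (by ext <;> simp [gi] <;> linarith)
      · exact half ⟨0, 1⟩ (by simp [halfNormD4]) (by ext <;> simp [gi] <;> linarith)
    · rcases sq_eq_sq_iff_eq_or_eq_neg.1 h with g | g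
      · exact full ⟨0, -1⟩ (by simp [halfNormD4]) (by ext <;> simp [gi] <;> linarith)
      · exact full ⟨0, 1⟩ (by simp [halfNormD4]) (by ext <;> simp [gi] <;> linarith)
    · rcases sq_eq_sq_iff_eq_or_eq_neg.1 h with g | g
      · exact full ⟨1, 0⟩ (by simp [halfNormD4]) (by ext <;> simp [gi] <;> linarith)
      · exact full ⟨-1, 0⟩ (by simp [halfNormD4]) (by ext <;> simp [gi] <;> linarith)
    · rcases sq_eq_sq_iff_eq_or_eq_neg.1 h with g | g
      · exact full ⟨0, -1⟩ (by simp [halfNormD4]) (by ext <;> simp [gi] <;> linarith)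
      · exact full ⟨0, 1⟩ (by simp [halfNormD4]) (by ext <;> simp [gi] <;> linarith)
    · rcases sq_eq_sq_iff_eq_or_eq_neg.1 h with g | g
      · exact full ⟨1, 0⟩ (by simp [halfNormD4]) (by ext <;> simp [gi] <;> linarith)
      · exact full ⟨-1, 0⟩ (by simp [halfNormD4]) (by ext <;> simp [gi] <;> linarith)

/-! ### Transitivity of the isometries of the model -/

theorem halfNorm_eq (v : M) : halfNorm v
    = (v.1.2 * star v.1.1).re + (v.1.2 * star v.1.1).im - halfNormD4 v.2.1 - halfNormD4 v.2.2 := by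
  simp [halfNorm]; ring

/-- A transvection leaves `a` unchanged and translates the `D₄` components by multiples of `a`. Its
parameter `n` adds `|a|² (n - n i)` to `c = b * star a`, which shifts `c.re - c.im` by `2 n |a|²`
and keeps `c.re + c.im`, a quantity already fixed by the norm. -/
theorem exists_reduced (v : M) (hv : v.1.1 ≠ 0) : ∃ g : U, (g.1 v).1.1 = v.1.1 ∧
    -absSq v.1.1 < ((g.1 v).1.2 * star v.1.1).re - ((g.1 v).1.2 * star v.1.1).im ∧
    ((g.1 v).1.2 * star v.1.1).re - ((g.1 v).1.2 * star v.1.1).im ≤ absSq v.1.1 ∧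
    (2 * halfNormD4 (g.1 v).2.1 < absSq v.1.1 ∨ 2 * halfNormD4 (g.1 v).2.1 = absSq v.1.1 ∧
      ∃ y, halfNormD4 y = 1 ∧ (1 + gi) * lam (g.1 v).2.1 y = -v.1.1) ∧
    2 * halfNormD4 (g.1 v).2.2 ≤ absSq v.1.1 := by
  obtain ⟨y₁, h₁⟩ := exists_D4_reduction v.1.1 hv v.2.1
  obtain ⟨y₂, h₂⟩ := exists_D4_reduction v.1.1 hv v.2.2
  have hA := absSq_pos hv
  set c := ((eichler (y₁, y₂) 0).1 v).1.2 * star v.1.1 with hc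
  obtain ⟨n, d, e, l, u⟩ := exists_rounding (c.re - c.im) (2 * absSq v.1.1) (by omega)
  have key : ((eichler (y₁, y₂) (-n)).1 v).1.2 * star v.1.1
      = c + ⟨absSq v.1.1 * -n, absSq v.1.1 * n⟩ := by
    rw [hc, eichler_apply, eichler_apply]
    ext <;> simp [absSq] <;> ring
  have hre : (((eichler (y₁, y₂) (-n)).1 v).1.2 * star v.1.1).re
      = c.re + absSq v.1.1 * -n := by rw [key]; rfl
  have him : (((eichler (y₁, y₂) (-n)).1 v).1.2 * star v.1.1).im
      = c.im + absSq v.1.1 * n := by rw [key]; rfl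
  refine ⟨eichler (y₁, y₂) (-n), rfl, ?_, ?_, h₁, ?_⟩
  · rw [hre, him]; linarith
  · rw [hre, him]; linarith
  · exact h₂.elim le_of_lt fun h => h.1.le

theorem absSq_gi_mul (b : GaussianInt) : absSq (-gi * b) = absSq b := by
  simp [absSq, gi]; ring

theorem two_mul_absSq (c : GaussianInt) :
    2 * absSq c = (c.re + c.im) ^ 2 + (c.re - c.im) ^ 2 := by
  simp only [absSq]; ring

/-- Let `A = |a|²`, `s = c.re + c.im` and `D = c.re - c.im` after reduction. Then `0 ≤ s ≤ A` and
`|D| ≤ A`, so `2|b|² A = s² + D² ≤ 2A²`. Exchanging `a` and `b` is a descent unless equality holds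
throughout. -/
theorem exists_descent_isotropic (v : M) (h0 : halfNorm v = 0) (hv : v.1.1 ≠ 0) :
    ∃ g : U, absSq (g.1 v).1.1 < absSq v.1.1 := by
  obtain ⟨g, ha, hD, hD', h₁, h₂⟩ := exists_reduced v hv
  have hA := absSq_pos hv
  have hw : halfNorm (g.1 v) = 0 := (g.2 v).trans h0
  set w := g.1 v with hwdef
  set c := w.1.2 * star v.1.1 with hc
  have hs : c.re + c.im = halfNormD4 w.2.1 + halfNormD4 w.2.2 := by
    have := halfNorm_eq w
    rw [ha, ← hc] at this
    linarith
  have hb : absSq w.1.2 * absSq v.1.1 = absSq c := by rw [hc, absSq_mul, absSq_star]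
  have h3 := two_mul_absSq c
  have n₁ := halfNormD4_nonneg w.2.1
  have n₂ := halfNormD4_nonneg w.2.2
  have hs0 : 0 ≤ c.re + c.im := by omega
  by_cases hlt : absSq w.1.2 < absSq v.1.1
  · refine ⟨hypSwap * g, ?_⟩
    change absSq (hypSwap.1 w).1.1 < _
    rw [hypSwap_apply, absSq_gi_mul]
    exact hlt
  · have hge : absSq v.1.1 * absSq v.1.1 ≤ absSq c := by
      rw [← hb]; exact mul_le_mul_of_nonneg_right (not_lt.1 hlt) hA.le
    have hsA : c.re + c.im ≤ absSq v.1.1 := by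
      rcases h₁ with h₁ | h₁ <;> omega
    -- Equality leaves `s = A` and `D = A`, the value `-A` being excluded by the half-open interval;
    -- hence `b = a`, and the first `D₄` component is a deep hole.
    have hs' : c.re + c.im = absSq v.1.1 := by nlinarith
    have hD2 : c.re - c.im = absSq v.1.1 := by nlinarith
    have hcc : c = v.1.1 * star v.1.1 := by
      rw [mul_star_eq]; ext <;> simp <;> linarith
    have hb' : w.1.2 = v.1.1 :=
      mul_right_cancel₀ (fun h => hv (star_eq_zero.1 h)) (hc.symm.trans hcc)
    obtain ⟨y, hy, hl⟩ : ∃ y, halfNormD4 y = 1 ∧ (1 + gi) * lam w.2.1 y = -v.1.1 := by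
      rcases h₁ with h₁ | h₁
      · omega
      · exact h₁.2
    -- From `(1 + i) * lam = -a`, the new coordinate is, up to a unit, `a + lam - i a = a(1 - i)/2`,
    -- whose norm is `A / 2`.
    refine ⟨hypSwap * eichler (y, 0) 0 * hypSwap * g, ?_⟩
    change absSq (hypSwap.1 ((eichler (y, 0) 0).1 (hypSwap.1 w))).1.1 < _
    rw [hypSwap_apply, absSq_gi_mul, eichler_apply, hypSwap_apply]
    have hre := congrArg Zsqrtd.re hl
    have him := congrArg Zsqrtd.im hl
    simp [gi] at hre him
    simp only [hy, hb', ha]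
    have hz : lam w.2.2 0 = 0 := by simp [lam]
    have hz' : halfNormD4 0 = 0 := by simp [halfNormD4]
    simp only [absSq] at hA ⊢
    simp [hz, hz', gi]
    have e1 : v.1.1.re = (lam w.2.1 y).im - (lam w.2.1 y).re := by linarith
    have e2 : v.1.1.im = -((lam w.2.1 y).re + (lam w.2.1 y).im) := by linarith
    rw [e1, e2] at hA ⊢
    nlinarith

/-- The descent ends at `a = 0`, where the definiteness of `D₄` kills the remaining components. -/
theorem exists_isotropic_normal_form (v : M) (h0 : halfNorm v = 0) :
    ∃ (g : U) (c : GaussianInt), g.1 v = ((0, c), 0, 0) := by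
  by_cases hv : v.1.1 = 0
  · have h := halfNorm_eq v
    have n₁ := halfNormD4_nonneg v.2.1
    have n₂ := halfNormD4_nonneg v.2.2
    rw [hv, h0] at h
    simp at h
    refine ⟨1, v.1.2, Prod.ext (Prod.ext hv rfl) (Prod.ext (?_ : v.2.1 = 0) (?_ : v.2.2 = 0))⟩
    · exact halfNormD4_eq_zero (by linarith)
    · exact halfNormD4_eq_zero (by linarith)
  · obtain ⟨g, hg⟩ := exists_descent_isotropic v h0 hv
    obtain ⟨g', c, h⟩ := exists_isotropic_normal_form (g.1 v) ((g.2 v).trans h0)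
    exact ⟨g' * g, c, h⟩
termination_by (absSq v.1.1).toNat
decreasing_by
  have := absSq_nonneg (g.1 v).1.1
  omega

/-! ### Vectors of norm `-2` -/

/-- The standard vector of norm `-2`. -/
def stdRoot : M := ((1, -gi), 0, 0)

theorem halfNorm_stdRoot : halfNorm stdRoot = -1 := by
  simp [halfNorm, halfNormD4, stdRoot, gi]

theorem absSq_eq_one {a : GaussianInt} (h : absSq a = 1) :
    a = 1 ∨ gi * a = 1 ∨ gi * (gi * a) = 1 ∨ gi * (gi * (gi * a)) = 1 := by
  simp only [absSq] at h
  have h1 : -1 ≤ a.re := by nlinarith [sq_nonneg a.im]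
  have h2 : a.re ≤ 1 := by nlinarith [sq_nonneg a.im]
  have h3 : -1 ≤ a.im := by nlinarith [sq_nonneg a.re]
  have h4 : a.im ≤ 1 := by nlinarith [sq_nonneg a.re]
  obtain ⟨x, y⟩ := a
  dsimp only at *
  interval_cases x <;> interval_cases y <;> simp at h <;> simp [gi, Zsqrtd.ext_iff]

theorem exists_unit_multiple_stdRoot (c : GaussianInt) (hc : absSq c = 1) :
    ∃ g : U, g.1 (c • stdRoot) = stdRoot := by
  rcases absSq_eq_one hc with h | h | h | h
  · exact ⟨1, by rw [h, one_smul]; rfl⟩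
  · refine ⟨unitI, ?_⟩
    rw [unitI_apply, smul_smul, h, one_smul]
  · refine ⟨unitI * unitI, ?_⟩
    change unitI.1 (unitI.1 _) = _
    rw [unitI_apply, unitI_apply, smul_smul, smul_smul, mul_assoc, h, one_smul]
  · refine ⟨unitI * unitI * unitI, ?_⟩
    change unitI.1 (unitI.1 (unitI.1 _)) = _
    rw [unitI_apply, unitI_apply, unitI_apply, smul_smul, smul_smul, smul_smul,
      mul_assoc, mul_assoc, h, one_smul]

/-- Now `-1 ≤ s ≤ A - 1`, so for `A > 1` the estimate `s² + D² < 2A²` is strict and deep holes cause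
no trouble. For `A = 1` the `D₄` components vanish and `s = -1`; parity leaves `D = 1`, so `b = -i
a` and the vector is a unit multiple of `stdRoot`. -/
theorem exists_descent_root (v : M) (h0 : halfNorm v = -1) (hv : v.1.1 ≠ 0) :
    (∃ g : U, g.1 v = stdRoot) ∨
      ∃ g : U, absSq (g.1 v).1.1 < absSq v.1.1 ∧ 1 < absSq v.1.1 := by
  obtain ⟨g, ha, hD, hD', h₁, h₂⟩ := exists_reduced v hv
  have hA := absSq_pos hv
  have hw : halfNorm (g.1 v) = -1 := (g.2 v).trans h0
  set w := g.1 v with hwdef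
  set c := w.1.2 * star v.1.1 with hc
  have hs : c.re + c.im = halfNormD4 w.2.1 + halfNormD4 w.2.2 - 1 := by
    have := halfNorm_eq w
    rw [ha, ← hc] at this
    linarith
  have hb : absSq w.1.2 * absSq v.1.1 = absSq c := by rw [hc, absSq_mul, absSq_star]
  have h3 := two_mul_absSq c
  have n₁ := halfNormD4_nonneg w.2.1
  have n₂ := halfNormD4_nonneg w.2.2
  have h₁' : 2 * halfNormD4 w.2.1 ≤ absSq v.1.1 := h₁.elim le_of_lt fun h => h.1.le
  rcases eq_or_lt_of_le (show 1 ≤ absSq v.1.1 by omega) with hone | hone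
  · left
    have z₁ : w.2.1 = 0 := halfNormD4_eq_zero (by omega)
    have z₂ : w.2.2 = 0 := halfNormD4_eq_zero (by omega)
    have z₁' : halfNormD4 w.2.1 = 0 := by omega
    have z₂' : halfNormD4 w.2.2 = 0 := by omega
    have hcc : c = -gi * v.1.1 * star v.1.1 := by
      rw [mul_assoc, mul_star_eq, ← hone]
      ext <;> simp [gi] <;> omega
    have hb' : w.1.2 = -gi * v.1.1 :=
      mul_right_cancel₀ (fun h => hv (star_eq_zero.1 h)) (hc.symm.trans hcc)
    obtain ⟨g', hg'⟩ := exists_unit_multiple_stdRoot v.1.1 hone.symm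
    refine ⟨g' * g, Eq.trans ?_ hg'⟩
    change g'.1 w = _
    congr 1
    refine Prod.ext (Prod.ext ?_ ?_) (Prod.ext ?_ ?_)
    · rw [ha]; simp [stdRoot]
    · rw [hb']; simp [stdRoot, mul_comm]
    · rw [z₁]; simp [stdRoot]
    · rw [z₂]; simp [stdRoot]
  · right
    refine ⟨hypSwap * g, ?_, hone⟩
    change absSq (hypSwap.1 w).1.1 < _
    rw [hypSwap_apply, absSq_gi_mul]
    refine lt_of_mul_lt_mul_right ?_ hA.le
    rw [hb]
    nlinarith

/-- In terms of `z` and `w`, `|z|² + |w|² = 2`. Either `w` is a unit, or one of them vanishes and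
`(z + w)/(1 + i)` is a unit. So `lam x` takes the form `t * star u` with `t` a unit on one of the
two coordinate axes. -/
theorem exists_lam_eq {x : GaussianInt × GaussianInt} (hx : halfNormD4 x = 1) (c : GaussianInt) :
    ∃ y, lam x y = c := by
  have h2 := two_mul_halfNormD4 x
  have n₁ := absSq_nonneg x.1
  have n₂ := absSq_nonneg (x.1 + (1 + gi) * x.2)
  have hsum : absSq (x.1 + (x.1 + (1 + gi) * x.2)) = 2 * absSq ((1 + gi) * x.1 + gi * x.2) := by
    simp [absSq, gi]; ring
  have of_unit : ∀ (t : GaussianInt) (f : GaussianInt → GaussianInt × GaussianInt), absSq t = 1 →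
      (∀ u, lam x (f u) = t * star u) → ∃ y, lam x y = c := by
    intro t f ht hf
    refine ⟨f (star c * t), ?_⟩
    rw [hf, star_mul, star_star, ← mul_assoc, mul_star_eq, ht]
    ext <;> simp
  have hw : absSq (x.1 + (1 + gi) * x.2) = 1 → ∃ y, lam x y = c := fun h =>
    of_unit _ (fun u => (0, u)) h (by intro u; simp [lam]; ring)
  have hz : absSq ((1 + gi) * x.1 + gi * x.2) = 1 → ∃ y, lam x y = c := fun h =>
    of_unit _ (fun u => (u, 0)) h (by intro u; simp [lam]; ring)
  rw [hx] at h2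
  obtain h | h | h : absSq x.1 = 0 ∨ absSq (x.1 + (1 + gi) * x.2) = 1 ∨
      absSq (x.1 + (1 + gi) * x.2) = 0 := by omega
  · apply hz
    have hx0 := absSq_eq_zero h
    simp [absSq, gi, hx0] at h2 ⊢
    linarith
  · exact hw h
  · apply hz
    rw [absSq_eq_zero h, add_zero] at hsum
    omega

/-- With `a = 0` the two `D₄` half-norms add up to 1, so one component is a root. By `exists_lam_eq`
a transvection then makes `b = 1`, and the swap moves it to the first place. -/
theorem exists_absSq_eq_one (v : M) (h0 : halfNorm v = -1) (hv : v.1.1 = 0) :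
    ∃ g : U, absSq (g.1 v).1.1 = 1 := by
  have h := halfNorm_eq v
  have n₁ := halfNormD4_nonneg v.2.1
  have n₂ := halfNormD4_nonneg v.2.2
  rw [hv, h0] at h
  simp at h
  obtain ⟨y, hy⟩ : ∃ y : (GaussianInt × GaussianInt) × (GaussianInt × GaussianInt),
      lam v.2.1 y.1 + lam v.2.2 y.2 = 1 - v.1.2 := by
    have hl : ∀ x, lam x 0 = 0 := fun x => by simp [lam]
    obtain h1 | h1 : halfNormD4 v.2.1 = 1 ∨ halfNormD4 v.2.2 = 1 := by omega
    · obtain ⟨y, hy⟩ := exists_lam_eq h1 (1 - v.1.2)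
      exact ⟨(y, 0), by rw [hy, hl, add_zero]⟩
    · obtain ⟨y, hy⟩ := exists_lam_eq h1 (1 - v.1.2)
      exact ⟨(0, y), by rw [hy, hl, zero_add]⟩
  refine ⟨hypSwap * eichler y 0, ?_⟩
  change absSq (hypSwap.1 ((eichler y 0).1 v)).1.1 = 1
  rw [hypSwap_apply, absSq_gi_mul, eichler_apply]
  simp only [hv, zero_mul, add_zero, add_assoc, hy]
  simp [absSq]

theorem exists_root_normal_form (v : M) (h0 : halfNorm v = -1) :
    ∃ g : U, g.1 v = stdRoot := by
  by_cases hv : v.1.1 = 0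
  · obtain ⟨g, hg⟩ := exists_absSq_eq_one v h0 hv
    have hne : (g.1 v).1.1 ≠ 0 := fun h => by simp [h, absSq] at hg
    -- The first coordinate is a unit, so the descent alternative is refuted by its clause `1 <
    -- absSq`.
    rcases exists_descent_root (g.1 v) ((g.2 v).trans h0) hne with ⟨g', h⟩ | ⟨g', -, h⟩
    · exact ⟨g' * g, h⟩
    · omega
  · rcases exists_descent_root v h0 hv with h | ⟨g, hg, -⟩
    · exact h
    · obtain ⟨g', h⟩ := exists_root_normal_form (g.1 v) ((g.2 v).trans h0)
      exact ⟨g' * g, h⟩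
termination_by (absSq v.1.1).toNat
decreasing_by
  have := absSq_nonneg (g.1 v).1.1
  omega

/-! ### The discriminant group as a vector space over `𝔽₂` -/

/-- The reduction `ℤ[i] → 𝔽₂` modulo `1 + i`. -/
def parity : GaussianInt →+* ZMod 2 := Zsqrtd.lift ⟨1, by decide⟩

theorem parity_apply (a : GaussianInt) : parity a = (a.re : ZMod 2) + (a.im : ZMod 2) := by
  simp [parity, Zsqrtd.lift]

theorem parity_star (a : GaussianInt) : parity (star a) = parity a := by
  simp only [parity_apply, Zsqrtd.re_star, Zsqrtd.im_star, Int.cast_neg, ZMod.neg_eq_self_mod_two]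

theorem parity_gi : parity gi = 1 := by simp [parity_apply, gi]

theorem parity_eq_zero {a : GaussianInt} (h : parity a = 0) : ∃ b, a = (1 - gi) * b := by
  rw [parity_apply, ← Int.cast_add] at h
  obtain ⟨k, hk⟩ := (ZMod.intCast_zmod_eq_zero_iff_dvd _ 2).1 h
  have hk' : a.re + a.im = 2 * k := hk
  refine ⟨⟨a.re - k, k⟩, ?_⟩
  ext <;> simp [gi] <;> linarith

/-- The reduction of the model modulo `1 + i`. -/
abbrev F : Type := (ZMod 2 × ZMod 2) × (ZMod 2 × ZMod 2) × (ZMod 2 × ZMod 2)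

/-- The reduction map. -/
def red : M →ₗ[ℤ] F where
  toFun v := ((parity v.1.1, parity v.1.2), (parity v.2.1.1, parity v.2.1.2),
    (parity v.2.2.1, parity v.2.2.2))
  map_add' v w := by simp only [Prod.fst_add, Prod.snd_add, map_add]; rfl
  map_smul' c v := by
    simp only [Prod.smul_fst, Prod.smul_snd, map_zsmul, RingHom.id_apply]; rfl

theorem red_apply (v : M) : red v = ((parity v.1.1, parity v.1.2),
    (parity v.2.1.1, parity v.2.1.2), (parity v.2.2.1, parity v.2.2.2)) := rfl

theorem red_smul (c : GaussianInt) (v : M) : red (c • v) = parity c • red v := by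
  simp only [red_apply, Prod.smul_fst, Prod.smul_snd, smul_eq_mul, map_mul]; rfl

/-- The quadratic form of `F`. -/
def quad (x : F) : ZMod 2 :=
  x.1.1 * x.1.2 + (x.2.1.1 + x.2.1.2 + x.2.1.1 * x.2.1.2)
    + (x.2.2.1 + x.2.2.2 + x.2.2.1 * x.2.2.2)

/-- The bilinear form of `F`. -/
def bil (x y : F) : ZMod 2 :=
  x.1.1 * y.1.2 + x.1.2 * y.1.1 + (x.2.1.1 * y.2.1.2 + x.2.1.2 * y.2.1.1)
    + (x.2.2.1 * y.2.2.2 + x.2.2.2 * y.2.2.1)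

theorem quad_add (x y : F) : quad (x + y) = quad x + quad y + bil x y := by
  simp only [quad, bil, Prod.fst_add, Prod.snd_add]; ring

theorem quad_red (v : M) : quad (red v) = (halfNorm v : ZMod 2) := by
  have sq' : ∀ t : ZMod 2, t ^ 2 = t := by decide
  have neg' : ∀ s t : ZMod 2, s - t = s + t := by decide
  simp only [quad, red_apply, parity_apply, halfNorm, halfNormD4, Int.cast_sub, Int.cast_add,
    Int.cast_mul, Int.cast_pow, sq', neg']
  ring

theorem parity_herm (v w : M) : parity (herm v w) = bil (red v) (red w) := by
  have neg' : ∀ s t : ZMod 2, s - t = s + t := by decide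
  simp only [herm, bil, red_apply, map_sub, map_add, map_mul, parity_star, parity_gi, map_one, neg',
    show (1 + 1 : ZMod 2) = 0 from by decide]
  ring

/-- Modulo `1 + i` the reflection of order 4 becomes an orthogonal transvection. -/
theorem red_reflection (r : M) (hr : halfNorm r = -1) (v : M) :
    red ((reflection r hr).1 v) = red v + bil (red v) (red r) • red r := by
  rw [reflection_apply, map_add, red_smul, parity_herm]

theorem red_surjective : Function.Surjective red := by
  have h : ∀ t : ZMod 2, ∃ a : GaussianInt, parity a = t := by
    intro t
    obtain ⟨n, rfl⟩ := ZMod.intCast_surjective t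
    exact ⟨⟨n, 0⟩, by simp [parity_apply]⟩
  intro x
  obtain ⟨a, ha⟩ := h x.1.1
  obtain ⟨b, hb⟩ := h x.1.2
  obtain ⟨p, hp⟩ := h x.2.1.1
  obtain ⟨q, hq⟩ := h x.2.1.2
  obtain ⟨r, hr⟩ := h x.2.2.1
  obtain ⟨s, hs⟩ := h x.2.2.2
  exact ⟨((a, b), (p, q), (r, s)), by rw [red_apply, ha, hb, hp, hq, hr, hs]⟩

theorem red_eq_zero_iff (v : M) : red v = 0 ↔ ∃ w, v = (1 - gi) • w := by
  constructor
  · intro h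
    obtain ⟨a, ha⟩ := parity_eq_zero (congrArg (fun x : F => x.1.1) h)
    obtain ⟨b, hb⟩ := parity_eq_zero (congrArg (fun x : F => x.1.2) h)
    obtain ⟨p, hp⟩ := parity_eq_zero (congrArg (fun x : F => x.2.1.1) h)
    obtain ⟨q, hq⟩ := parity_eq_zero (congrArg (fun x : F => x.2.1.2) h)
    obtain ⟨r, hr⟩ := parity_eq_zero (congrArg (fun x : F => x.2.2.1) h)
    obtain ⟨s, hs⟩ := parity_eq_zero (congrArg (fun x : F => x.2.2.2) h)
    exact ⟨((a, b), (p, q), (r, s)), Prod.ext (Prod.ext ha hb)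
      (Prod.ext (Prod.ext hp hq) (Prod.ext hr hs))⟩
  · rintro ⟨w, rfl⟩
    rw [red_smul, map_sub, parity_gi, map_one, sub_self, zero_smul]

/-! ### The class map and the identification of `A_N` with `F` -/

/-- The class map `phi` as a linear map. -/
def phiLin : N →ₗ[ℤ] AN where
  toFun := phi
  map_add' x y := by
    rw [phi, phi, phi, ← map_add]
    congr 1
    refine Subtype.ext ?_
    change phiQ (x + y) = phiQ x + phiQ y
    rw [phiQ, phiQ, phiQ, ← TensorProduct.tmul_add, map_add]
    congr 1; abel
  map_smul' c x := by
    rw [phi, phi, RingHom.id_apply, ← map_smul]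
    congr 1
    refine Subtype.ext ?_
    change phiQ (c • x) = c • phiQ x
    rw [phiQ, phiQ, map_smul, ← smul_add, TensorProduct.tmul_smul]

theorem eq_zero_of_form (x : N) (h : ∀ y, form x y = 0) : x = 0 := by
  obtain ⟨v, rfl⟩ := modelEquiv.surjective x
  have h1 : ∀ w, polar v w = 0 := fun w => by rw [← form_modelEquiv]; exact h _
  have a1 := h1 ((1, 0), 0, 0)
  have a2 := h1 ((gi, 0), 0, 0)
  have b1 := h1 ((0, 1), 0, 0)
  have b2 := h1 ((0, gi), 0, 0)
  have p1 := h1 (0, (1, 0), 0)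
  have p2 := h1 (0, (gi, 0), 0)
  have q1 := h1 (0, (0, 1), 0)
  have q2 := h1 (0, (0, gi), 0)
  have r1 := h1 (0, 0, (1, 0))
  have r2 := h1 (0, 0, (gi, 0))
  have s1 := h1 (0, 0, (0, 1))
  have s2 := h1 (0, 0, (0, gi))
  simp only [polar, halfNorm, halfNormD4, gi, Prod.fst_add, Prod.snd_add, Zsqrtd.re_add,
    Zsqrtd.im_add, Zsqrtd.re_zero, Zsqrtd.im_zero, Zsqrtd.re_one, Zsqrtd.im_one, Prod.fst_zero,
    Prod.snd_zero] at a1 a2 b1 b2 p1 p2 q1 q2 r1 r2 s1 s2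
  ring_nf at a1 a2 b1 b2 p1 p2 q1 q2 r1 r2 s1 s2
  have : v = 0 := by
    refine Prod.ext (Prod.ext (Zsqrtd.ext ?_ ?_) (Zsqrtd.ext ?_ ?_))
      (Prod.ext (Prod.ext (Zsqrtd.ext ?_ ?_) (Zsqrtd.ext ?_ ?_))
        (Prod.ext (Zsqrtd.ext ?_ ?_) (Zsqrtd.ext ?_ ?_))) <;>
    simp only [Prod.fst_zero, Prod.snd_zero, Zsqrtd.re_zero, Zsqrtd.im_zero] <;> omega
  rw [this, map_zero]

theorem toNQ_injective : Function.Injective toNQ := by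
  rw [← LinearMap.ker_eq_bot, LinearMap.ker_eq_bot']
  intro x hx
  refine eq_zero_of_form x fun y => ?_
  have h := formQ_toNQ x y
  rw [hx, map_zero, LinearMap.zero_apply] at h
  exact_mod_cast h.symm

theorem exists_smul_eq_toNQ (x : NQ) : ∃ (m : ℤ) (n : N), m ≠ 0 ∧ m • x = toNQ n := by
  induction x using TensorProduct.induction_on with
  | zero => exact ⟨1, 0, one_ne_zero, by simp⟩
  | tmul a n =>
    refine ⟨a.den, a.num • n, by exact_mod_cast a.den_ne_zero, ?_⟩
    change _ = (1 : ℚ) ⊗ₜ[ℤ] (a.num • n)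
    rw [TensorProduct.tmul_smul, TensorProduct.smul_tmul', TensorProduct.smul_tmul']
    congr 1
    rw [zsmul_eq_mul, zsmul_eq_mul, mul_one, Int.cast_natCast, mul_comm]
    exact Rat.mul_den_eq_num a
  | add x y hx hy =>
    obtain ⟨m, n, hm, h⟩ := hx
    obtain ⟨m', n', hm', h'⟩ := hy
    refine ⟨m * m', m' • n + m • n', mul_ne_zero hm hm', ?_⟩
    rw [map_add, map_smul, map_smul, ← h, ← h', smul_add, smul_smul, smul_smul, mul_comm m' m]

theorem zsmul_NQ_cancel {m : ℤ} (hm : m ≠ 0) {x y : NQ} (h : m • x = m • y) : x = y := by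
  rw [← Int.cast_smul_eq_zsmul ℚ, ← Int.cast_smul_eq_zsmul ℚ] at h
  exact smul_right_injective NQ (Int.cast_ne_zero.2 hm) h

theorem eq_of_formQ {x x' : NQ} (h : ∀ y : N, formQ x (toNQ y) = formQ x' (toNQ y)) : x = x' := by
  obtain ⟨m, n, hm, hn⟩ := exists_smul_eq_toNQ (x - x')
  have h0 : n = 0 := by
    refine eq_zero_of_form n fun y => ?_
    have h1 := formQ_toNQ n y
    rw [← hn, map_zsmul, LinearMap.smul_apply, map_sub, LinearMap.sub_apply, h y, sub_self,
      smul_zero] at h1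
    exact_mod_cast h1.symm
  rw [h0, map_zero] at hn
  exact sub_eq_zero.1 (zsmul_NQ_cancel hm (hn.trans (smul_zero m).symm))

/-- `(v + i v)/2 = v/(1 - i)`, which lies in the lattice exactly when `v` is divisible by `1 - i`.
-/
theorem phi_eq_zero_iff (v : M) : phi (modelEquiv v) = 0 ↔ red v = 0 := by
  have h1 : phi (modelEquiv v) = 0 ↔ ∃ n, toNQ n = phiQ (modelEquiv v) :=
    Submodule.Quotient.mk_eq_zero _
  have h2 : ∀ n, toNQ n = phiQ (modelEquiv v) ↔
      (2 : ℤ) • n = modelEquiv v + rho (modelEquiv v) := by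
    intro n
    have e : toNQ (modelEquiv v + rho (modelEquiv v)) = (2 : ℤ) • phiQ (modelEquiv v) := by
      change (1 : ℚ) ⊗ₜ[ℤ] _ = _
      rw [phiQ, TensorProduct.smul_tmul']
      congr 1
      norm_num
    rw [← toNQ_injective.eq_iff, map_smul, e]
    constructor
    · intro h; rw [h]
    · intro h
      exact zsmul_NQ_cancel two_ne_zero h
  rw [h1, red_eq_zero_iff]
  simp only [h2]
  constructor
  · rintro ⟨n, hn⟩
    obtain ⟨w, rfl⟩ := modelEquiv.surjective n
    rw [rho_modelEquiv, ← map_smul, ← map_add] at hn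
    have h3 := modelEquiv.injective hn
    refine ⟨w, ?_⟩
    have h4 : v + gi • v = (1 + gi) • v := by rw [add_smul, one_smul]
    have h5 : (2 : ℤ) • w = (1 + gi) • (1 - gi) • w := by
      rw [smul_smul, gaussian_smul_eq]
      simp [gi]
    rw [h4, h5] at h3
    refine smul_right_injective M (r := 1 + gi) ?_ h3.symm
    intro h
    simpa [gi] using congrArg Zsqrtd.im h
  · rintro ⟨w, rfl⟩
    refine ⟨modelEquiv w, ?_⟩
    rw [rho_modelEquiv, ← map_smul, ← map_add]
    congr 1
    rw [smul_smul, ← add_smul, gaussian_smul_eq]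
    simp [gi]

theorem form_add_rho (v w : M) : form (modelEquiv v + rho (modelEquiv v)) (modelEquiv w)
    = polar (v + gi • v) w := by
  rw [rho_modelEquiv, ← map_add, form_modelEquiv]

/-- Unimodularity of `herm`: every functional on the model is represented by a vector. -/
theorem exists_polar_eq (l : M →ₗ[ℤ] ℤ) : ∃ v, ∀ w, polar (v + gi • v) w = 2 * l w := by
  set p : GaussianInt := ⟨l (0, (1, 0), 0), l (0, (gi, 0), 0)⟩ with hp
  set q : GaussianInt := ⟨l (0, (0, 1), 0), l (0, (0, gi), 0)⟩ with hq
  set r : GaussianInt := ⟨l (0, 0, (1, 0)), l (0, 0, (gi, 0))⟩ with hr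
  set s : GaussianInt := ⟨l (0, 0, (0, 1)), l (0, 0, (0, gi))⟩ with hs
  -- The witness comes from inverting the Gram matrix of `herm`. This is possible over `ℤ[i]`, since
  -- the hyperbolic block has unit entries off the diagonal and each `D₄` block has determinant
  -- `-i`.
  refine ⟨((-gi * ⟨l ((0, 1), 0, 0), l ((0, gi), 0, 0)⟩, ⟨l ((1, 0), 0, 0), l ((gi, 0), 0, 0)⟩),
    (gi * ((1 + gi) * p - gi * q), gi * ((1 + gi) * q - p)),
    (gi * ((1 + gi) * r - gi * s), gi * ((1 + gi) * s - r))), fun w => ?_⟩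
  have hw : w = w.1.1.re • ((1, 0), 0, 0) + w.1.1.im • ((gi, 0), 0, 0)
      + w.1.2.re • ((0, 1), 0, 0) + w.1.2.im • ((0, gi), 0, 0)
      + w.2.1.1.re • (0, (1, 0), 0) + w.2.1.1.im • (0, (gi, 0), 0)
      + w.2.1.2.re • (0, (0, 1), 0) + w.2.1.2.im • (0, (0, gi), 0)
      + w.2.2.1.re • (0, 0, (1, 0)) + w.2.2.1.im • (0, 0, (gi, 0))
      + w.2.2.2.re • (0, 0, (0, 1)) + w.2.2.2.im • (0, 0, (0, gi)) := by
    ext <;> simp [gi]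
  have hl := congrArg l hw
  simp only [map_add, map_smul, smul_eq_mul] at hl
  rw [hl]
  simp only [polar, halfNorm, halfNormD4, gi, hp, hq, hr, hs, Prod.fst_add, Prod.snd_add,
    Prod.smul_fst, Prod.smul_snd, smul_eq_mul, Zsqrtd.re_add, Zsqrtd.im_add, Zsqrtd.re_mul,
    Zsqrtd.im_mul, Zsqrtd.re_neg, Zsqrtd.im_neg, Zsqrtd.re_sub, Zsqrtd.im_sub, Zsqrtd.re_one,
    Zsqrtd.im_one]
  ring

/-- A dual vector is an integral functional on `N`; unimodularity represents it by some `(v + ρ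
v)/2`. -/
theorem phi_surjective : Function.Surjective phi := by
  intro α
  obtain ⟨d, rfl⟩ := NinDual.mkQ_surjective α
  choose f hf using d.2
  let l : N →ₗ[ℤ] ℤ := {
    toFun := f
    map_add' := fun x y => by
      have h : ((f (x + y) : ℤ) : ℚ) = (f x + f y : ℤ) := by
        rw [← hf, map_add, map_add, hf, hf, Int.cast_add]
      exact_mod_cast h
    map_smul' := fun c x => by
      have h : ((f (c • x) : ℤ) : ℚ) = (c • f x : ℤ) := by
        rw [← hf, map_smul, map_zsmul, hf, zsmul_eq_mul, smul_eq_mul, Int.cast_mul]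
      exact_mod_cast h }
  obtain ⟨v, hv⟩ := exists_polar_eq (l.comp (modelEquiv : M →ₗ[ℤ] N))
  refine ⟨modelEquiv v, ?_⟩
  rw [phi]
  congr 1
  refine Subtype.ext (eq_of_formQ fun y => ?_)
  obtain ⟨w, rfl⟩ := modelEquiv.surjective y
  change formQ (phiQ (modelEquiv v)) (toNQ (modelEquiv w)) = _
  rw [hf]
  refine (formQ_tmul _ _ _ _).trans ?_
  rw [form_add_rho, hv]
  change ((2 * f (modelEquiv w) : ℤ) : ℚ) * _ = _
  push_cast
  ring

/-- The identification of the discriminant group with `F`. -/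
def discEquiv : AN ≃ₗ[ℤ] F :=
  ((Submodule.quotEquivOfEq _ _ (by
      ext v
      rw [LinearMap.mem_ker, LinearMap.mem_ker]
      exact phi_eq_zero_iff v)).symm.trans
    ((phiLin.comp (modelEquiv : M →ₗ[ℤ] N)).quotKerEquivOfSurjective
      (phi_surjective.comp modelEquiv.surjective))).symm.trans
    (red.quotKerEquivOfSurjective red_surjective)

theorem discEquiv_phi (v : M) : discEquiv (phi (modelEquiv v)) = red v := by
  have h : (((phiLin.comp (modelEquiv : M →ₗ[ℤ] N)).quotKerEquivOfSurjective
      (phi_surjective.comp modelEquiv.surjective))) (Submodule.Quotient.mk v)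
      = phi (modelEquiv v) := rfl
  rw [← h]
  simp only [discEquiv, LinearEquiv.trans_apply, LinearEquiv.trans_symm, LinearEquiv.symm_symm,
    LinearEquiv.symm_apply_apply]
  rfl

/-- As `|(1 + i)/2|² = 1/2`, the value of `q_N` at `phi v` is `halfNorm v` modulo 2, and `quad` is
its reduction. -/
theorem qN_phi_eq_zero_iff (v : M) : qN (phi (modelEquiv v)) = 0 ↔ quad (red v) = 0 := by
  have h1 : qN (phi (modelEquiv v)) = ((halfNorm v : ℚ) : ℚ ⧸ AddSubgroup.zmultiples (2 : ℚ)) := by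
    change ((formQ (phiQ _) (phiQ _) : ℚ) : ℚ ⧸ AddSubgroup.zmultiples (2 : ℚ)) = _
    congr 1
    refine (formQ_tmul _ _ _ _).trans ?_
    have h2 : form (modelEquiv v + rho (modelEquiv v)) (modelEquiv v + rho (modelEquiv v))
        = 4 * halfNorm v := by
      rw [rho_modelEquiv, ← map_add, form_modelEquiv_self]
      simp [halfNorm, halfNormD4, gi]
      ring
    rw [h2]
    push_cast
    ring
  rw [h1, QuotientAddGroup.eq_zero_iff, AddSubgroup.mem_zmultiples_iff, quad_red,
    ZMod.intCast_zmod_eq_zero_iff_dvd]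
  constructor
  · rintro ⟨k, hk⟩
    refine ⟨k, ?_⟩
    rw [zsmul_eq_mul] at hk
    have : ((k * 2 : ℤ) : ℚ) = (halfNorm v : ℤ) := by push_cast; exact hk
    have := Int.cast_injective this
    push_cast
    linarith
  · rintro ⟨k, hk⟩
    refine ⟨k, ?_⟩
    rw [hk, zsmul_eq_mul]
    push_cast
    ring

theorem qN_eq_zero_iff (α : AN) : qN α = 0 ↔ quad (discEquiv α) = 0 := by
  obtain ⟨x, rfl⟩ := phi_surjective α
  obtain ⟨v, rfl⟩ := modelEquiv.surjective x
  rw [qN_phi_eq_zero_iff, discEquiv_phi]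

theorem GamToOq_phi (g : Gam) (x : N) : (GamToOq g).1 (phi x) = phi (g.1 x) := by
  change NinDual.mkQ _ = NinDual.mkQ _
  congr 1
  refine Subtype.ext ?_
  change (1 / 2 : ℚ) ⊗ₜ[ℤ] g.1 (x + rho x) = (1 / 2 : ℚ) ⊗ₜ[ℤ] (g.1 x + rho (g.1 x))
  rw [map_add, g.2.2]

theorem discEquiv_GamToOq (g : U) (v : M) :
    discEquiv ((GamToOq (toGam g)).1 (phi (modelEquiv v))) = red (g.1 v) := by
  rw [GamToOq_phi, toGam_modelEquiv, discEquiv_phi]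

/-! ### The discriminant form and eight points -/

/-- Eight points of `F` such that the non-isotropic vectors are the sums of two of them. -/
def pt : Fin 8 → F :=
  ![((0, 0), (0, 0), (0, 0)), ((0, 0), (1, 0), (0, 0)), ((0, 0), (1, 1), (0, 0)),
    ((0, 1), (0, 1), (0, 0)), ((1, 1), (0, 1), (0, 1)), ((1, 1), (0, 1), (1, 1)),
    ((1, 1), (0, 1), (1, 0)), ((1, 0), (0, 1), (0, 0))]

theorem quad_pt_add {i j : Fin 8} : i ≠ j → quad (pt i + pt j) = 1 := by
  revert i j; decide +kernel

theorem exists_eq_pt_add {x : F} : quad x = 1 → ∃ i j, i ≠ j ∧ x = pt i + pt j := by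
  revert x; decide +kernel

/-- The bilinear form counts common points of two pairs modulo 2. -/
theorem bil_pt (i j k l : Fin 8) : bil (pt i + pt j) (pt k + pt l) =
    (if i = k then 1 else 0) + (if i = l then 1 else 0) + (if j = k then 1 else 0)
      + (if j = l then 1 else 0) := by
  revert i j k l; decide +kernel

theorem eq_or_eq_of_pt_add_eq {i j k l : Fin 8} :
    i ≠ j → pt i + pt j = pt k + pt l → k = i ∧ l = j ∨ k = j ∧ l = i := by
  revert i j k l; decide +kernel

/-- An even set has at most four points up to complement, and since `pt 0 = 0` a four-set can be
chosen to contain the point 0. -/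
theorem exists_eq_three_pt (x : F) : ∃ i j k, x = pt i + pt j + pt k := by
  revert x; decide +kernel

theorem transvection_pt {i j : Fin 8} (k l : Fin 8) : i ≠ j →
    pt k + pt l + bil (pt k + pt l) (pt i + pt j) • (pt i + pt j)
      = pt (Equiv.swap i j k) + pt (Equiv.swap i j l) := by
  revert i j k l; decide +kernel

theorem pt_zero : pt 0 = 0 := rfl

theorem bil_one_pt {i : Fin 8} : i ≠ 0 → i ≠ 1 → bil (pt 1) (pt i) = 1 := by
  revert i; decide +kernel

theorem bil_two_pt {i : Fin 8} : i ≠ 0 → i ≠ 2 → bil (pt 2) (pt i) = 1 := by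
  revert i; decide +kernel

theorem pt_ne {i : Fin 8} : pt i ≠ pt 1 + pt 2 := by
  revert i; decide +kernel

theorem F_add_self (x : F) : x + x = 0 := by
  revert x; decide +kernel

/-- A non-isotropic vector meeting two edges at a vertex is an edge at that vertex, or closes the
triangle. -/
theorem mem_star {c d e : Fin 8} {z : F} (hde : d ≠ e)
    (hz : quad z = 1) (h₁ : bil (pt c + pt d) z = 1) (h₂ : bil (pt c + pt e) z = 1)
    (h₃ : z ≠ pt d + pt e) : ∃ k, z = pt c + pt k := by
  obtain ⟨k, l, hkl, rfl⟩ := exists_eq_pt_add hz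
  rw [bil_pt] at h₁ h₂
  have e0 : ¬ (0 : ZMod 2) = 1 := by decide
  by_cases hk : c = k
  · exact ⟨l, by rw [hk]⟩
  by_cases hl : c = l
  · exact ⟨k, by rw [hl, add_comm]⟩
  exfalso
  rw [if_neg hk, if_neg hl, add_zero, zero_add] at h₁ h₂
  have hd : d = k ∨ d = l := by
    by_contra h
    push Not at h
    rw [if_neg h.1, if_neg h.2] at h₁
    simp at h₁
  have he : e = k ∨ e = l := by
    by_contra h
    push Not at h
    rw [if_neg h.1, if_neg h.2] at h₂
    simp at h₂
  rcases hd with rfl | rfl <;> rcases he with rfl | rfl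
  · exact hde rfl
  · exact h₃ rfl
  · exact h₃ (add_comm _ _)
  · exact hde rfl

/-- Non-isotropic vectors are pairs, and product 1 means that they share exactly one point `c`. -/
theorem exists_star {x y : F} (hx : quad x = 1) (hy : quad y = 1) (hxy : bil x y = 1) :
    ∃ c d e, c ≠ d ∧ c ≠ e ∧ d ≠ e ∧ x = pt c + pt d ∧ y = pt c + pt e := by
  obtain ⟨i, j, hij, rfl⟩ := exists_eq_pt_add hx
  obtain ⟨k, l, hkl, rfl⟩ := exists_eq_pt_add hy
  rw [bil_pt] at hxy
  have e0 : ¬ (0 : ZMod 2) = 1 := by decide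
  by_cases h1 : i = k
  · subst h1
    refine ⟨i, j, l, hij, hkl, ?_, rfl, rfl⟩
    rintro rfl
    rw [if_pos rfl, if_neg hij, if_neg hij.symm, if_pos rfl] at hxy
    simp at hxy
  by_cases h2 : i = l
  · subst h2
    refine ⟨i, j, k, hij, hkl.symm, ?_, rfl, add_comm _ _⟩
    rintro rfl
    rw [if_pos rfl, if_neg hij, if_neg hij.symm, if_pos rfl] at hxy
    simp at hxy
  by_cases h3 : j = k
  · subst h3
    exact ⟨j, i, l, hij.symm, hkl, h2, add_comm _ _, rfl⟩
  by_cases h4 : j = l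
  · subst h4
    exact ⟨j, i, k, hij.symm, hkl.symm, h1, add_comm _ _, add_comm _ _⟩
  exfalso
  rw [if_neg h1, if_neg h2, if_neg h3, if_neg h4] at hxy
  simp at hxy

/-- Every isometry of `F` permutes the eight points, up to a common translation. -/
theorem exists_perm (f : F →+ F) (hf : Function.Injective f) (hq : ∀ x, quad (f x) = quad x) :
    ∃ σ : Equiv.Perm (Fin 8), ∀ i j, f (pt i + pt j) = pt (σ i) + pt (σ j) := by
  have hb : ∀ x y, bil (f x) (f y) = bil x y := by
    intro x y
    have h := hq (x + y)
    rw [map_add, quad_add, quad_add, hq, hq] at h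
    exact add_left_cancel h
  have hquad : ∀ i, i ≠ 0 → quad (f (pt i)) = 1 := by
    intro i hi
    rw [hq, ← zero_add (pt i), ← pt_zero]
    exact quad_pt_add hi.symm
  -- The point `c` common to the images of `{0, 1}` and `{0, 2}` is the image of 0. Every other pair
  -- `{0, i}` meets both of them and differs from `{1, 2}`, so `mem_star` puts its image through `c`
  -- too.
  obtain ⟨c, d, e, hcd, hce, hde, h₁, h₂⟩ := exists_star (hquad 1 (by decide)) (hquad 2 (by decide))
    ((hb _ _).trans (bil_one_pt (by decide) (by decide)))
  have H : ∀ i, ∃ k, f (pt i) = pt c + pt k := by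
    intro i
    by_cases h0 : i = 0
    · exact ⟨c, by rw [h0, pt_zero, map_zero, F_add_self]⟩
    by_cases h1 : i = 1
    · exact ⟨d, by rw [h1, h₁]⟩
    by_cases h2 : i = 2
    · exact ⟨e, by rw [h2, h₂]⟩
    refine mem_star hde (hquad i h0) ?_ ?_ ?_
    · rw [← h₁, hb, bil_one_pt h0 h1]
    · rw [← h₂, hb, bil_two_pt h0 h2]
    · have : pt d + pt e = f (pt 1) + f (pt 2) := by
        rw [h₁, h₂, add_add_add_comm, F_add_self, zero_add]
      rw [this, ← map_add]
      exact fun h => pt_ne (hf h)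
  choose s hs using H
  have hinj : Function.Injective s := by
    intro i j hij
    have h : pt i = pt j := hf (by rw [hs, hs, hij])
    by_contra hne
    have := quad_pt_add hne
    rw [h, F_add_self] at this
    exact absurd this (by decide)
  refine ⟨Equiv.ofBijective s (Finite.injective_iff_bijective.1 hinj), fun i j => ?_⟩
  rw [map_add, hs, hs, add_add_add_comm, F_add_self, zero_add]
  rfl

/-! ### From `O(q_N)` to permutations of eight points -/

/-- The vector of the discriminant group that corresponds to a pair of points. -/
def edge (i j : Fin 8) : AN := discEquiv.symm (pt i + pt j)

theorem discEquiv_edge (i j : Fin 8) : discEquiv (edge i j) = pt i + pt j :=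
  discEquiv.apply_symm_apply _

theorem edge_eq {i j k l : Fin 8} (h : i ≠ j) (h' : edge i j = edge k l) :
    k = i ∧ l = j ∨ k = j ∧ l = i :=
  eq_or_eq_of_pt_add_eq h (discEquiv.symm.injective h')

theorem exists_perm_edge (g : Oq) :
    ∃ σ : Equiv.Perm (Fin 8), ∀ i j, g.1 (edge i j) = edge (σ i) (σ j) := by
  let f : F ≃+ F := ((discEquiv.symm.trans g.1).trans discEquiv).toAddEquiv
  have hf : ∀ x, f x = discEquiv (g.1 (discEquiv.symm x)) := fun _ => rfl
  obtain ⟨σ, hσ⟩ := exists_perm f.toAddMonoidHom f.injective (by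
    intro x
    change quad (f x) = quad x
    -- Preserving isotropy is enough, because `quad` has only two values.
    have h : quad (f x) = 0 ↔ quad x = 0 := by
      rw [hf, ← qN_eq_zero_iff, g.2, qN_eq_zero_iff, LinearEquiv.apply_symm_apply]
    have e : ∀ s t : ZMod 2, (s = 0 ↔ t = 0) → s = t := by decide
    exact e _ _ h)
  refine ⟨σ, fun i j => discEquiv.injective ?_⟩
  rw [discEquiv_edge]
  exact hσ i j

/-- A point is the intersection of two pairs through it, so a permutation is determined by its
action on pairs. -/
theorem perm_eq_of_edge {σ τ : Equiv.Perm (Fin 8)}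
    (h : ∀ i j, edge (σ i) (σ j) = edge (τ i) (τ j)) : σ = τ := by
  ext1 i
  have h3 : ∀ i : Fin 8, ∃ j k, i ≠ j ∧ i ≠ k ∧ j ≠ k := by decide
  obtain ⟨j, k, hij, hik, hjk⟩ := h3 i
  rcases edge_eq (σ.injective.ne hij) (h i j) with h1 | h1
  · exact h1.1.symm
  rcases edge_eq (σ.injective.ne hik) (h i k) with h2 | h2
  · exact h2.1.symm
  exact absurd (h1.1.symm.trans h2.1) (σ.injective.ne hjk)

theorem eq_of_edge {g h : Oq} (H : ∀ i j, g.1 (edge i j) = h.1 (edge i j)) : g = h := by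
  refine Subtype.ext (LinearEquiv.ext fun α => ?_)
  obtain ⟨i, j, k, hα⟩ := exists_eq_three_pt (discEquiv α)
  have : α = edge i j + edge 0 k := by
    apply discEquiv.injective
    rw [hα, map_add, discEquiv_edge, discEquiv_edge, pt_zero, zero_add]
  rw [this, map_add, map_add, H, H]

theorem Oq_mul_apply (g h : Oq) (α : AN) : (g * h).1 α = g.1 (h.1 α) := by
  rw [Subgroup.coe_mul, LinearEquiv.mul_apply]

/-- The permutation of the eight points induced by an isometry of the discriminant form. -/
def permFun (g : Oq) : Equiv.Perm (Fin 8) := (exists_perm_edge g).choose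

theorem apply_edge_permFun (g : Oq) (i j : Fin 8) :
    g.1 (edge i j) = edge (permFun g i) (permFun g j) :=
  (exists_perm_edge g).choose_spec i j

theorem permFun_mul (g h : Oq) : permFun (g * h) = permFun g * permFun h := by
  refine perm_eq_of_edge fun i j => ?_
  rw [← apply_edge_permFun, Equiv.Perm.mul_apply, Equiv.Perm.mul_apply, ← apply_edge_permFun,
    ← apply_edge_permFun, Oq_mul_apply]

/-- The homomorphism from the orthogonal group of the discriminant form to `S₈`. -/
def permOf : Oq →* Equiv.Perm (Fin 8) where
  toFun := permFun
  map_one' := by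
    have h := permFun_mul 1 1
    rwa [mul_one, left_eq_mul] at h
  map_mul' := permFun_mul

theorem permOf_apply (g : Oq) : permOf g = permFun g := rfl

theorem apply_edge (g : Oq) (i j : Fin 8) : g.1 (edge i j) = edge (permOf g i) (permOf g j) := by
  rw [permOf_apply, apply_edge_permFun]

theorem permOf_eq {g : Oq} {σ : Equiv.Perm (Fin 8)}
    (h : ∀ i j, g.1 (edge i j) = edge (σ i) (σ j)) : permOf g = σ :=
  perm_eq_of_edge fun i j => by rw [← apply_edge, h]

theorem permOf_injective : Function.Injective permOf := by
  intro g h H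
  refine eq_of_edge fun i j => ?_
  rw [apply_edge g, H, ← apply_edge h]

/-- A subgroup of a symmetric group that contains the transpositions of equivalent elements contains
the permutations that preserve all equivalence classes. -/
theorem mem_of_swap_mem {α : Type*} [DecidableEq α] [Fintype α] (r : α → α → Prop)
    (hr : Equivalence r) (H : Subgroup (Equiv.Perm α))
    (hH : ∀ i j, r i j → i ≠ j → Equiv.swap i j ∈ H) (σ : Equiv.Perm α) (hσ : ∀ i, r (σ i) i) :
    σ ∈ H := by
  by_cases h1 : σ = 1
  · rw [h1]; exact H.one_mem
  obtain ⟨i, hi⟩ : ∃ i, σ i ≠ i := by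
    by_contra h
    push Not at h
    exact h1 (Equiv.ext h)
  -- Composing with the transposition of `i` and `σ i` fixes `i` and shrinks the support, while each
  -- class is still preserved.
  have hlt := Equiv.Perm.card_support_swap_mul hi
  have hrec := mem_of_swap_mem r hr H hH (Equiv.swap i (σ i) * σ) (by
    intro k
    rw [Equiv.Perm.mul_apply]
    by_cases hk : σ k = i
    · rw [hk, Equiv.swap_apply_left]
      exact hr.trans (hσ i) (hk ▸ hσ k)
    by_cases hk' : σ k = σ i
    · rw [hk', Equiv.swap_apply_right, σ.injective hk']
      exact hr.refl i
    · rw [Equiv.swap_apply_of_ne_of_ne hk hk']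
      exact hσ k)
  have hs := hH i (σ i) (hr.symm (hσ i)) (Ne.symm hi)
  have : σ = Equiv.swap i (σ i) * (Equiv.swap i (σ i) * σ) := by
    rw [← mul_assoc, Equiv.swap_mul_self, one_mul]
  rw [this]
  exact H.mul_mem hs hrec
termination_by σ.support.card

/-! ### Reflections and transpositions -/

/-- Lifts of the elements of `𝔽₂`. -/
def liftBit (t : ZMod 2) : GaussianInt := if t = 0 then 0 else 1

/-- Lifts of the classes of `D₄` to vectors of minimal norm. -/
def liftD4 (x : ZMod 2 × ZMod 2) : GaussianInt × GaussianInt :=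
  (liftBit x.1, if x.1 = 0 then liftBit x.2 else -liftBit x.2)

/-- Lifts of the non-isotropic vectors of `F` to vectors of norm `-2`. -/
def rootLift (x : F) : M :=
  ((liftBit x.1.1, if x.1 = (1, 1) ∧ x.2.1 = 0 then -gi else liftBit x.1.2),
    liftD4 x.2.1, liftD4 x.2.2)

/-- Each `D₄` plane of `F` is anisotropic, and `liftD4` sends its non-zero classes to roots. The
hyperbolic part then has to contribute 0 or 1, except for the class `(1, 1)` with no `D₄` part,
where `-i` instead of 1 gives `-1`. -/
theorem halfNorm_rootLift {x : F} : quad x = 1 → halfNorm (rootLift x) = -1 := by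
  revert x; decide +kernel

theorem parity_liftBit (t : ZMod 2) : parity (liftBit t) = t := by
  have h : ∀ t : ZMod 2, t = 0 ∨ t = 1 := by decide
  rcases h t with rfl | rfl <;> simp [liftBit]

theorem red_rootLift (x : F) : red (rootLift x) = x := by
  have h : ∀ y : ZMod 2 × ZMod 2, (parity (liftD4 y).1, parity (liftD4 y).2) = y := by
    intro y
    have h1 : parity (if y.1 = 0 then liftBit y.2 else -liftBit y.2) = y.2 := by
      split_ifs
      · exact parity_liftBit _
      · rw [map_neg, parity_liftBit, ZMod.neg_eq_self_mod_two]
    simp only [liftD4, h1, parity_liftBit]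
  refine Prod.ext (Prod.ext (parity_liftBit _) ?_) (Prod.ext (h _) (h _))
  change parity (if _ then _ else _) = _
  split_ifs with h1
  · rw [map_neg, parity_gi, h1.1]; rfl
  · exact parity_liftBit _

/-- The reflection that induces the transposition of two points. -/
def pairReflection {i j : Fin 8} (h : i ≠ j) : U :=
  reflection (rootLift (pt i + pt j)) (halfNorm_rootLift (quad_pt_add h))

/-- The action of `Γ` on the eight points. -/
def gamPerm : Gam →* Equiv.Perm (Fin 8) := permOf.comp GamToOq

theorem GamToOq_edge (g : Gam) (i j : Fin 8) :
    (GamToOq g).1 (edge i j) = edge (gamPerm g i) (gamPerm g j) := apply_edge (GamToOq g) i j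

theorem GamToOq_eq_of_gamPerm {g h : Gam} (H : gamPerm g = gamPerm h) : GamToOq g = GamToOq h :=
  permOf_injective H

theorem exists_phi_eq_edge (k l : Fin 8) :
    ∃ v, red v = pt k + pt l ∧ phi (modelEquiv v) = edge k l := by
  obtain ⟨v, hv⟩ := red_surjective (pt k + pt l)
  exact ⟨v, hv, discEquiv.injective (by rw [discEquiv_phi, hv, discEquiv_edge])⟩

theorem gamPerm_toGam {g : U} {σ : Equiv.Perm (Fin 8)}
    (h : ∀ v k l, red v = pt k + pt l → red (g.1 v) = pt (σ k) + pt (σ l)) :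
    gamPerm (toGam g) = σ := by
  refine permOf_eq fun k l => discEquiv.injective ?_
  obtain ⟨v, hv, hv'⟩ := exists_phi_eq_edge k l
  rw [← hv', discEquiv_GamToOq, discEquiv_edge, h v k l hv]

theorem gamPerm_pairReflection {i j : Fin 8} (h : i ≠ j) :
    gamPerm (toGam (pairReflection h)) = Equiv.swap i j := by
  refine gamPerm_toGam fun v k l hv => ?_
  rw [pairReflection, red_reflection, red_rootLift, hv, transvection_pt k l h]

theorem gamPerm_surjective : Function.Surjective gamPerm := by
  intro σ
  refine mem_of_swap_mem (fun _ _ => True) ⟨fun _ => trivial, fun _ => trivial,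
    fun _ _ => trivial⟩ gamPerm.range (fun i j _ h => ⟨_, gamPerm_pairReflection h⟩) σ
    fun _ => trivial

theorem ker_gamPerm : gamPerm.ker = GamOneSubI :=
  MonoidHom.ker_comp_of_injective GamToOq permOf permOf_injective

/-- The quotient `Γ / Γ(1 - i)` is the symmetric group of the eight points. -/
def quotientEquivPerm : (Gam ⧸ GamOneSubI) ≃* Equiv.Perm (Fin 8) :=
  (QuotientGroup.quotientMulEquivOfEq ker_gamPerm.symm).trans
    (QuotientGroup.quotientKerEquivOfSurjective gamPerm gamPerm_surjective)

/-! ### Orbits of the kernel -/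

theorem mul_mul_mem_ker {G Q : Type*} [Group G] [Group Q] (θ : G →* Q) {d g g' : G}
    (h : θ d = θ (g' * g⁻¹)) : g'⁻¹ * d * g ∈ θ.ker := by
  rw [MonoidHom.mem_ker, map_mul, map_mul, h, map_mul, map_inv, map_inv]
  group

/-- If `Γ` acts transitively on `X` and every element of `Γ` fixing the class of a base point acts
on the discriminant group like an element fixing the base point, then an equivariant map to the
discriminant group classifies the orbits of the kernel. -/
theorem exists_orbit_equiv {X : Type*} [MulAction Gam X] (f : X → AN) (P : AN → Prop)
    (hP : ∀ x, P (f x)) (hsurj : ∀ α, P α → ∃ x, f x = α)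
    (hf : ∀ (g : Gam) (x : X), f (g • x) = (GamToOq g).1 (f x)) (x₀ : X)
    (htrans : ∀ x, ∃ g : Gam, g • x = x₀)
    (hstab : ∀ g : Gam, (GamToOq g).1 (f x₀) = f x₀ →
      ∃ d : Gam, d • x₀ = x₀ ∧ GamToOq d = GamToOq g) :
    ∃ E : MulAction.orbitRel.Quotient GamOneSubI X ≃ {α : AN // P α},
      ∀ x, (E (Quotient.mk _ x)).1 = f x := by
  have hker : ∀ (g : GamOneSubI) (x : X), f (g • x) = f x := by
    intro g x
    change f (g.1 • x) = _
    rw [hf, MonoidHom.mem_ker.1 g.2]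
    rfl
  let e : MulAction.orbitRel.Quotient GamOneSubI X → {α : AN // P α} :=
    Quotient.lift (fun x => ⟨f x, hP x⟩) (by
      rintro x y ⟨g, rfl⟩
      exact Subtype.ext (hker g y))
  have he : ∀ x, (e (Quotient.mk _ x)).1 = f x := fun x => rfl
  refine ⟨Equiv.ofBijective e ⟨?_, ?_⟩, he⟩
  · intro a b
    induction a using Quotient.inductionOn with | _ x => ?_
    induction b using Quotient.inductionOn with | _ y => ?_
    intro hab
    have hxy : f x = f y := congrArg Subtype.val hab
    obtain ⟨g, hg⟩ := htrans x
    obtain ⟨g', hg'⟩ := htrans y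
    obtain ⟨d, hd, hd'⟩ := hstab (g' * g⁻¹) (by
      have h1 : (g' * g⁻¹) • x₀ = g' • x := by rw [mul_smul, ← hg, inv_smul_smul]
      refine (hf (g' * g⁻¹) x₀).symm.trans ?_
      rw [h1]
      refine (hf g' x).trans ?_
      rw [hxy]
      refine (hf g' y).symm.trans ?_
      rw [hg'])
    -- `g` carries `x` to the base point, `d` fixes it and `g'⁻¹` carries it on to `y`; the product
    -- is in the kernel because `d` acts on `A_N` like `g' * g⁻¹`.
    refine (Quotient.sound (s := MulAction.orbitRel GamOneSubI X) ?_ : Quotient.mk _ y = _).symm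
    refine ⟨⟨g'⁻¹ * d * g, mul_mul_mem_ker GamToOq hd'⟩, ?_⟩
    · change (g'⁻¹ * d * g) • x = y
      rw [mul_smul, mul_smul, hg, hd, ← hg', inv_smul_smul]
  · rintro ⟨α, hα⟩
    obtain ⟨x, rfl⟩ := hsurj α hα
    exact ⟨Quotient.mk _ x, rfl⟩

/-- A lifting criterion for stabilizers in terms of transpositions. -/
theorem exists_stabilizer_lift {X : Type*} [MulAction Gam X] (x₀ : X)
    (r : Fin 8 → Fin 8 → Prop) (hr : Equivalence r)
    (hswap : ∀ i j (h : i ≠ j), r i j → toGam (pairReflection h) • x₀ = x₀) (g : Gam)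
    (hg : ∀ i, r (gamPerm g i) i) : ∃ d : Gam, d • x₀ = x₀ ∧ GamToOq d = GamToOq g := by
  obtain ⟨d, hd, hd'⟩ := mem_of_swap_mem r hr ((MulAction.stabilizer Gam x₀).map gamPerm)
    (fun i j hij h => ⟨toGam (pairReflection h), hswap i j h hij, gamPerm_pairReflection h⟩)
    (gamPerm g) hg
  exact ⟨d, hd, GamToOq_eq_of_gamPerm hd'⟩

/-! ### The sublattices `A₁ ⊕ A₁` -/

/-- `i ≡ 1` modulo `1 + i`. -/
theorem phi_rho (x : N) : phi (rho x) = phi x := by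
  obtain ⟨v, rfl⟩ := modelEquiv.surjective x
  apply discEquiv.injective
  rw [rho_modelEquiv, discEquiv_phi, discEquiv_phi, red_smul, parity_gi, one_smul]

theorem phi_combination (m n : ℤ) (x : N) : phi (m • x + n • rho x) = (m + n) • phi x := by
  have h : ∀ y, phi y = phiLin y := fun _ => rfl
  rw [h, map_add, map_smul, map_smul, ← h, ← h, phi_rho, add_smul]

theorem zsmul_AN (k : ℤ) (α : AN) : k • α = 0 ∨ k • α = α := by
  have h2 : (2 : ℤ) • α = 0 := by
    apply discEquiv.injective
    rw [two_smul, map_add, F_add_self, map_zero]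
  rcases Int.even_or_odd' k with ⟨c, rfl | rfl⟩
  · left; rw [mul_comm, mul_smul, h2, smul_zero]
  · right; rw [add_smul, mul_comm, mul_smul, h2, smul_zero, one_smul, zero_add]

theorem form_rho_self (x : N) : form x (rho x) = 0 := by
  have h := form_rho_rho x (rho x)
  rw [rho_rho, map_neg, form_comm] at h
  linarith

theorem form_rho_left (x : N) : form (rho x) x = 0 := by rw [form_comm, form_rho_self]

theorem form_combination (m n m' n' : ℤ) (x : N) :
    form (m • x + n • rho x) (m' • x + n' • rho x) = (m * m' + n * n') * form x x := by
  simp only [map_add, map_smul, LinearMap.add_apply, LinearMap.smul_apply, smul_eq_mul,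
    form_rho_rho, form_rho_self, form_rho_left]
  ring

theorem phi_ne_zero_of_root {r : N} (hr : form r r = -2) : qN (phi r) ≠ 0 := by
  obtain ⟨v, rfl⟩ := modelEquiv.surjective r
  rw [Ne, qN_phi_eq_zero_iff, quad_red]
  rw [form_modelEquiv_self] at hr
  rw [show halfNorm v = -1 by omega]
  decide

theorem isRhoA1A1_span {r : N} (hr : form r r = -2) :
    IsRhoA1A1 (Submodule.span ℤ {r, rho r}) := by
  let f : (ℤ × ℤ) →ₗ[ℤ] N :=
    (LinearMap.toSpanSingleton ℤ N r).coprod (LinearMap.toSpanSingleton ℤ N (rho r))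
  have hf : ∀ s, f s = s.1 • r + s.2 • rho r := fun _ => rfl
  have hinj : Function.Injective f := by
    rw [← LinearMap.ker_eq_bot, LinearMap.ker_eq_bot']
    intro s hs
    have h := form_combination s.1 s.2 s.1 s.2 r
    rw [← hf, hs, map_zero, hr] at h
    have h1 : s.1 = 0 := by nlinarith
    have h2 : s.2 = 0 := by nlinarith
    exact Prod.ext h1 h2
  have hrange : LinearMap.range f = Submodule.span ℤ {r, rho r} := by
    ext x
    rw [Submodule.mem_span_pair]
    constructor
    · rintro ⟨s, rfl⟩; exact ⟨s.1, s.2, rfl⟩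
    · rintro ⟨a, b, rfl⟩; exact ⟨(a, b), rfl⟩
  refine ⟨?_, (LinearEquiv.ofInjective f hinj).trans (LinearEquiv.ofEq _ _ hrange), fun s t => ?_⟩
  · rw [Submodule.map_span, Set.image_pair, rho_rho]
    apply le_antisymm
    · rw [Submodule.span_le]
      rintro x (rfl | rfl)
      · exact Submodule.subset_span (by simp)
      · exact neg_mem (Submodule.subset_span (by simp))
    · rw [Submodule.span_le]
      rintro x (rfl | rfl)
      · rw [← neg_neg x]; exact neg_mem (Submodule.subset_span (by simp))
      · exact Submodule.subset_span (by simp)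
  · change form (f s) (f t) = _
    rw [hf, hf, form_combination, hr, formA1A1]
    ring

/-- The sublattice spanned by `r` and `ρ(r)`, for a vector `r` of norm `-2`. -/
def RhoA1A1.ofRoot {r : N} (hr : form r r = -2) : RhoA1A1 := ⟨_, isRhoA1A1_span hr⟩

theorem RhoA1A1.mem_ofRoot {r : N} (hr : form r r = -2) : r ∈ (RhoA1A1.ofRoot hr).1 :=
  Submodule.subset_span (by simp)

theorem RhoA1A1.exists_root (R : RhoA1A1) : ∃ r ∈ R.1, form r r = -2 := by
  obtain ⟨-, e, he⟩ := R.2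
  refine ⟨e (1, 0), (e (1, 0)).2, ?_⟩
  rw [he]; rfl

theorem RhoA1A1.rho_mem (R : RhoA1A1) {x : N} (hx : x ∈ R.1) : rho x ∈ R.1 := by
  have h := Submodule.mem_map_of_mem (f := rho) hx
  rwa [R.2.1] at h

/-- Orthonormal rows of a 2 × 2 integral matrix give orthonormal columns. -/
theorem orthonormal_int {a b c d : ℤ} (h₁ : a ^ 2 + b ^ 2 = 1) (h₂ : c ^ 2 + d ^ 2 = 1)
    (h₃ : a * c + b * d = 0) : a ^ 2 + c ^ 2 = 1 ∧ b ^ 2 + d ^ 2 = 1 ∧ a * b + c * d = 0 := by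
  have a1 : -1 ≤ a := by nlinarith [sq_nonneg b]
  have a2 : a ≤ 1 := by nlinarith [sq_nonneg b]
  have b1 : -1 ≤ b := by nlinarith [sq_nonneg a]
  have b2 : b ≤ 1 := by nlinarith [sq_nonneg a]
  have c1 : -1 ≤ c := by nlinarith [sq_nonneg d]
  have c2 : c ≤ 1 := by nlinarith [sq_nonneg d]
  have d1 : -1 ≤ d := by nlinarith [sq_nonneg c]
  have d2 : d ≤ 1 := by nlinarith [sq_nonneg c]
  interval_cases a <;> interval_cases b <;> simp at h₁ <;> interval_cases c <;>
    simp at h₂ h₃ <;> simp_all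

/-- `r` and `ρ(r)` are orthogonal of norm `-2`, so their coordinates in `A₁ ⊕ A₁` form an orthogonal
integral matrix, whose inverse is its transpose; hence they are a basis. -/
theorem RhoA1A1.eq_span (R : RhoA1A1) {r : N} (hr : r ∈ R.1) (h : form r r = -2) :
    R.1 = Submodule.span ℤ {r, rho r} := by
  apply le_antisymm
  · intro x hx
    obtain ⟨-, e, he⟩ := R.2
    obtain ⟨s, hs⟩ := e.surjective ⟨r, hr⟩
    obtain ⟨t, ht⟩ := e.surjective ⟨rho r, R.rho_mem hr⟩
    obtain ⟨u, hu⟩ := e.surjective ⟨x, hx⟩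
    have hs' : (e s : N) = r := congrArg Subtype.val hs
    have ht' : (e t : N) = rho r := congrArg Subtype.val ht
    have hu' : (e u : N) = x := congrArg Subtype.val hu
    have h1 := he s s
    have h2 := he t t
    have h3 := he s t
    rw [hs', h, formA1A1] at h1
    rw [ht', form_rho_rho, h, formA1A1] at h2
    rw [hs', ht', form_rho_self, formA1A1] at h3
    obtain ⟨k1, k2, k3⟩ := orthonormal_int (a := s.1) (b := s.2) (c := t.1) (d := t.2)
      (by linarith) (by linarith) (by linarith)
    rw [Submodule.mem_span_pair]
    refine ⟨u.1 * s.1 + u.2 * s.2, u.1 * t.1 + u.2 * t.2, ?_⟩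
    rw [← ht', ← hs', ← hu', ← Submodule.coe_smul, ← Submodule.coe_smul, ← Submodule.coe_add,
      ← map_smul, ← map_smul, ← map_add]
    congr 2
    refine Prod.ext ?_ ?_ <;> simp
    · linear_combination u.1 * k1 + u.2 * k3
    · linear_combination u.2 * k2 + u.1 * k3
  · rw [Submodule.span_le]
    rintro x (rfl | rfl)
    · exact hr
    · exact R.rho_mem hr

theorem RhoA1A1.ext_root {R R' : RhoA1A1} {r : N} (hr : form r r = -2) (h : r ∈ R.1)
    (h' : r ∈ R'.1) : R = R' :=
  Subtype.ext ((R.eq_span h hr).trans (R'.eq_span h' hr).symm)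

/-- The second root is `m r + n ρ(r)`, with class `(m + n) • phi r`. `A_N` is 2-elementary, so this
is 0 or `phi r`, and 0 is excluded as roots have non-isotropic class. -/
theorem RhoA1A1.phi_eq (R : RhoA1A1) {r r' : N} (h : r ∈ R.1) (h' : r' ∈ R.1)
    (hr : form r r = -2) (hr' : form r' r' = -2) : phi r = phi r' := by
  rw [R.eq_span h hr, Submodule.mem_span_pair] at h'
  obtain ⟨m, n, rfl⟩ := h'
  rw [phi_combination]
  rcases zsmul_AN (m + n) (phi r) with h0 | h0
  · exfalso
    refine phi_ne_zero_of_root hr' ?_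
    rw [phi_combination, h0, qN_eq_zero_iff, map_zero]
    decide
  · exact h0.symm

theorem RhoA1A1.smul_mem (g : Gam) (R : RhoA1A1) {x : N} (hx : x ∈ R.1) : g.1 x ∈ (g • R).1 :=
  Submodule.mem_map_of_mem (f := (g.1 : N →ₗ[ℤ] N)) hx

/-- The class in the discriminant group of the vectors of norm `-2` of `R`. -/
def RhoA1A1.cls (R : RhoA1A1) : AN := phi R.exists_root.choose

theorem RhoA1A1.cls_eq (R : RhoA1A1) {r : N} (h : r ∈ R.1) (hr : form r r = -2) :
    R.cls = phi r :=
  R.phi_eq R.exists_root.choose_spec.1 h R.exists_root.choose_spec.2 hr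

theorem RhoA1A1.cls_smul (g : Gam) (R : RhoA1A1) : (g • R).cls = (GamToOq g).1 R.cls := by
  obtain ⟨r, h, hr⟩ := R.exists_root
  rw [R.cls_eq h hr, GamToOq_phi]
  exact RhoA1A1.cls_eq _ (RhoA1A1.smul_mem g R h) ((g.2.1 r r).trans hr)

theorem form_stdRoot : form (modelEquiv stdRoot) (modelEquiv stdRoot) = -2 := by
  rw [form_modelEquiv_self, halfNorm_stdRoot]; rfl

/-- The standard `ρ`-invariant sublattice `A₁ ⊕ A₁`. -/
def stdRhoA1A1 : RhoA1A1 := RhoA1A1.ofRoot form_stdRoot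

theorem stdRoot_mem : modelEquiv stdRoot ∈ stdRhoA1A1.1 := RhoA1A1.mem_ofRoot form_stdRoot

theorem exists_smul_eq_stdRhoA1A1 (R : RhoA1A1) : ∃ g : Gam, g • R = stdRhoA1A1 := by
  obtain ⟨r, h, hr⟩ := R.exists_root
  obtain ⟨v, rfl⟩ := modelEquiv.surjective r
  rw [form_modelEquiv_self] at hr
  obtain ⟨g, hg⟩ := exists_root_normal_form v (by omega)
  refine ⟨toGam g, RhoA1A1.ext_root form_stdRoot ?_ stdRoot_mem⟩
  have h1 := RhoA1A1.smul_mem (toGam g) R h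
  rwa [toGam_modelEquiv, hg] at h1

theorem toGam_smul_stdRhoA1A1 (g : U) (c : GaussianInt) (h : g.1 stdRoot = c • stdRoot) :
    toGam g • stdRhoA1A1 = stdRhoA1A1 := by
  have h1 : (toGam g).1 (modelEquiv stdRoot) = modelEquiv (c • stdRoot) := by
    rw [toGam_modelEquiv, h]
  refine RhoA1A1.ext_root (r := (toGam g).1 (modelEquiv stdRoot)) ?_
    (RhoA1A1.smul_mem _ _ stdRoot_mem) ?_
  · exact ((toGam g).2.1 _ _).trans form_stdRoot
  · rw [h1, gaussian_smul_eq, map_add, map_smul, map_smul, ← rho_modelEquiv]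
    exact Submodule.mem_span_pair.2 ⟨_, _, rfl⟩

theorem phi_stdRoot : phi (modelEquiv stdRoot) = edge 3 7 := by
  apply discEquiv.injective
  rw [discEquiv_phi, discEquiv_edge]
  simp only [red_apply, stdRoot, map_one, map_neg, parity_gi, Prod.fst_zero, Prod.snd_zero,
    map_zero]
  decide

/-- Pairs respecting the partition into `{3, 7}` and its complement are disjoint from `{3, 7}` or
equal to it. The lifts are chosen so that orthogonality to `stdRoot` holds exactly, and not only
modulo `1 + i`. -/
theorem reflection_apply_stdRoot {i j : Fin 8} : (i = 3 ∨ i = 7 ↔ j = 3 ∨ j = 7) → i ≠ j →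
    herm stdRoot (rootLift (pt i + pt j)) = 0 ∨ rootLift (pt i + pt j) = stdRoot := by
  revert i j; decide +kernel

theorem exists_orbit_equiv_RhoA1A1 :
    ∃ E : MulAction.orbitRel.Quotient GamOneSubI RhoA1A1 ≃ {α : AN // qN α ≠ 0},
      ∀ (R : RhoA1A1) (r : N), r ∈ R.1 → form r r = -2 → (E (Quotient.mk _ R)).1 = phi r := by
  have hcls : stdRhoA1A1.cls = edge 3 7 := by
    rw [RhoA1A1.cls_eq _ stdRoot_mem form_stdRoot, phi_stdRoot]
  obtain ⟨E, hE⟩ := exists_orbit_equiv RhoA1A1.cls (fun α => qN α ≠ 0)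
    (fun R => phi_ne_zero_of_root R.exists_root.choose_spec.2)
    (by
      intro α hα
      rw [Ne, qN_eq_zero_iff] at hα
      have e : ∀ t : ZMod 2, t ≠ 0 → t = 1 := by decide
      have hr : form (modelEquiv (rootLift (discEquiv α))) (modelEquiv (rootLift (discEquiv α)))
          = -2 := by
        rw [form_modelEquiv_self, halfNorm_rootLift (e _ hα)]; rfl
      refine ⟨RhoA1A1.ofRoot hr, ((RhoA1A1.ofRoot hr).cls_eq (RhoA1A1.mem_ofRoot hr) hr).trans ?_⟩
      apply discEquiv.injective
      rw [discEquiv_phi, red_rootLift])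
    RhoA1A1.cls_smul stdRhoA1A1 exists_smul_eq_stdRhoA1A1 (by
      intro g hg
      rw [hcls, GamToOq_edge] at hg
      -- Fixing the class means preserving `{3, 7}`, so the permutation lies in `S₂ × S₆`, which is
      -- generated by transpositions inside the two parts.
      have h1 := edge_eq (by decide) hg.symm
      refine exists_stabilizer_lift stdRhoA1A1 (fun i j => (i = 3 ∨ i = 7 ↔ j = 3 ∨ j = 7))
        ⟨fun _ => Iff.rfl, Iff.symm, Iff.trans⟩ ?_ g ?_
      · intro i j hij h
        rcases reflection_apply_stdRoot h hij with h' | h'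
        · refine toGam_smul_stdRhoA1A1 _ 1 ?_
          rw [pairReflection, reflection_apply, h', zero_smul, add_zero, one_smul]
        · refine toGam_smul_stdRhoA1A1 _ (1 + herm stdRoot stdRoot) ?_
          rw [pairReflection, reflection_apply, h', add_smul, one_smul]
      · intro i
        have h3 : ∀ k, gamPerm g i = gamPerm g k ↔ i = k := fun k => (gamPerm g).injective.eq_iff
        rw [← h3 3, ← h3 7]
        rcases h1 with ⟨e1, e2⟩ | ⟨e1, e2⟩ <;> rw [e1, e2]
        exact or_comm)
  exact ⟨E, fun R r h hr => (hE R).trans (R.cls_eq h hr)⟩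

instance : MulAction.IsPretransitive Gam RhoA1A1 := by
  constructor
  intro R R'
  obtain ⟨g, hg⟩ := exists_smul_eq_stdRhoA1A1 R
  obtain ⟨g', hg'⟩ := exists_smul_eq_stdRhoA1A1 R'
  exact ⟨g'⁻¹ * g, by rw [mul_smul, hg, ← hg', inv_smul_smul]⟩

/-! ### Cusps -/

theorem gaussVec_sub (a b c d : N) : gaussVec a b - gaussVec c d = gaussVec (a - c) (b - d) := by
  simp only [gaussVec, TensorProduct.tmul_sub]; abel

theorem formC_gaussVec (a b y : N) :
    formC (gaussVec a b) ((1 : ℂ) ⊗ₜ[ℤ] y) = form a y + Complex.I * form b y := by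
  rw [gaussVec, map_add, LinearMap.add_apply, formC_tmul, formC_tmul]
  ring

theorem gaussVec_eq_zero {a b : N} (h : gaussVec a b = 0) : a = 0 ∧ b = 0 := by
  have h1 : ∀ y, form a y = 0 ∧ form b y = 0 := by
    intro y
    have h2 := formC_gaussVec a b y
    rw [h, map_zero, LinearMap.zero_apply] at h2
    have hre := congrArg Complex.re h2
    have him := congrArg Complex.im h2
    simp at hre him
    exact ⟨by exact_mod_cast hre.symm, by exact_mod_cast him.symm⟩
  exact ⟨eq_zero_of_form a fun y => (h1 y).1, eq_zero_of_form b fun y => (h1 y).2⟩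

theorem I_smul_gaussVec (a b : N) : Complex.I • gaussVec a b = gaussVec (-b) a := by
  rw [gaussVec, smul_add, TensorProduct.smul_tmul', TensorProduct.smul_tmul', smul_eq_mul,
    smul_eq_mul, mul_one, Complex.I_mul_I, gaussVec, TensorProduct.tmul_neg, TensorProduct.neg_tmul]
  abel

theorem rhoC_gaussVec (a b : N) : rhoC (gaussVec a b) = gaussVec (rho a) (rho b) := by
  rw [gaussVec, map_add, rhoC_tmul, rhoC_tmul, gaussVec]

theorem extC_gaussVec (g : N ≃ₗ[ℤ] N) (a b : N) :
    extC g (gaussVec a b) = gaussVec (g a) (g b) := by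
  rw [gaussVec, map_add, extC_tmul, extC_tmul, gaussVec]

theorem conjC_gaussVec (a b : N) : conjC (gaussVec a b) = gaussVec a (-b) := by
  rw [gaussVec, map_add, conjC_tmul, conjC_tmul, gaussVec, Complex.conj_I, map_one,
    TensorProduct.tmul_neg, TensorProduct.neg_tmul]

theorem formC_gaussVec_conj (a b : N) :
    formC (gaussVec a b) (conjC (gaussVec a b)) = form a a + form b b := by
  rw [conjC_gaussVec, gaussVec, gaussVec]
  simp only [map_add, LinearMap.add_apply, formC_tmul, map_neg, form_comm b a]
  push_cast
  linear_combination (-(form b b : ℂ)) * Complex.I_mul_I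

theorem gaussVec_mem_Vplus_iff (a b : N) : gaussVec a b ∈ Vplus ↔ b = -rho a := by
  rw [mem_Vplus, rhoC_gaussVec, I_smul_gaussVec]
  constructor
  · intro h
    have h1 := (gaussVec_eq_zero ((gaussVec_sub _ _ _ _).symm.trans (sub_eq_zero.2 h))).1
    rw [sub_neg_eq_add] at h1
    exact eq_neg_of_add_eq_zero_right h1
  · rintro rfl
    rw [map_neg, rho_rho, neg_neg, neg_neg]

theorem conjC_smul (c : ℂ) (z : NC) : conjC (c • z) = starRingEnd ℂ c • conjC z := by
  induction z using TensorProduct.induction_on with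
  | zero => simp
  | add x y hx hy => rw [smul_add, map_add, hx, hy, map_add, smul_add]
  | tmul a n =>
    rw [TensorProduct.smul_tmul', conjC_tmul, conjC_tmul, TensorProduct.smul_tmul', smul_eq_mul,
      smul_eq_mul, map_mul]

theorem gaussVec_neg_rho_ne_zero {x : N} (hx : x ≠ 0) : gaussVec x (-rho x) ≠ 0 :=
  fun h => hx (gaussVec_eq_zero h).1

/-- The cusp attached to an isotropic vector of `N`. -/
def Cusp.ofIsotropic (x : N) (hx : x ≠ 0) (h : form x x = 0) : Cusp :=
  ⟨Projectivization.mk ℂ (gaussVec x (-rho x)) (gaussVec_neg_rho_ne_zero hx), by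
    refine ⟨⟨?_, ?_⟩, x, -rho x, Projectivization.submodule_mk _ _⟩
    · rw [Projectivization.submodule_mk, Submodule.span_singleton_le_iff_mem,
        gaussVec_mem_Vplus_iff]
    · rw [Projectivization.submodule_mk]
      intro z hz
      obtain ⟨c, rfl⟩ := Submodule.mem_span_singleton.1 hz
      rw [conjC_smul, map_smul, map_smul, LinearMap.smul_apply, formC_gaussVec_conj, map_neg,
        map_neg, LinearMap.neg_apply, neg_neg, form_rho_rho, h]
      simp⟩

theorem Cusp.ofIsotropic_submodule (x : N) (hx : x ≠ 0) (h : form x x = 0) :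
    (Cusp.ofIsotropic x hx h).1.submodule = Submodule.span ℂ {gaussVec x (-rho x)} :=
  Projectivization.submodule_mk _ _

theorem Cusp.mem_lattice_iff (c : Cusp) (x : N) :
    x ∈ c.lattice ↔ gaussVec x (-rho x) ∈ c.1.submodule := Iff.rfl

theorem Cusp.ext_submodule {c c' : Cusp} (h : c.1.submodule = c'.1.submodule) : c = c' :=
  Subtype.ext (Projectivization.submodule_injective h)

theorem Cusp.mem_lattice_ofIsotropic (x : N) (hx : x ≠ 0) (h : form x x = 0) :
    x ∈ (Cusp.ofIsotropic x hx h).lattice := by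
  rw [Cusp.mem_lattice_iff, Cusp.ofIsotropic_submodule]
  exact Submodule.mem_span_singleton_self _

theorem Cusp.eq_ofIsotropic {c : Cusp} {x : N} (hx : x ≠ 0) (h : form x x = 0)
    (hc : x ∈ c.lattice) : c = Cusp.ofIsotropic x hx h := by
  have hne := gaussVec_neg_rho_ne_zero hx
  refine Cusp.ext_submodule ?_
  rw [Cusp.ofIsotropic_submodule]
  obtain ⟨a, b, hab⟩ := c.2.2
  rw [Cusp.mem_lattice_iff, hab] at hc
  obtain ⟨t, ht⟩ := Submodule.mem_span_singleton.1 hc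
  rw [hab, ← ht]
  refine (Submodule.span_singleton_smul_eq (IsUnit.mk0 t ?_) _).symm
  rintro rfl
  rw [zero_smul] at ht
  exact hne ht.symm

/-- A Gaussian generator `a + i b` of the line lies in `V₊`, so `b = -ρ(a)`; its Hermitian norm is
`2⟨a, a⟩`, hence `a` is isotropic. -/
theorem Cusp.exists_mem_lattice (c : Cusp) : ∃ x, x ≠ 0 ∧ form x x = 0 ∧ x ∈ c.lattice := by
  obtain ⟨a, b, hab⟩ := c.2.2
  have hmem : gaussVec a b ∈ c.1.submodule := hab ▸ Submodule.mem_span_singleton_self _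
  have hb := (gaussVec_mem_Vplus_iff a b).1 (c.2.1.1 hmem)
  subst hb
  refine ⟨a, ?_, ?_, hmem⟩
  · rintro rfl
    have h0 : gaussVec (0 : N) (-rho 0) = 0 := by simp [gaussVec]
    rw [h0, Submodule.span_zero_singleton] at hab
    have h1 := Projectivization.rep_nonzero c.1
    have h2 : c.1.rep ∈ c.1.submodule := by
      rw [Projectivization.submodule_eq]
      exact Submodule.mem_span_singleton_self _
    rw [hab, Submodule.mem_bot] at h2
    exact h1 h2
  · have h := c.2.1.2 _ hmem
    rw [formC_gaussVec_conj, map_neg, map_neg, LinearMap.neg_apply, neg_neg, form_rho_rho] at h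
    have h' : ((form a a + form a a : ℤ) : ℂ) = 0 := by push_cast; exact h
    have := Int.cast_eq_zero.1 h'
    omega

theorem Cusp.smul_mem_lattice (g : Gam) {c : Cusp} {x : N} (hx : x ∈ c.lattice) :
    g.1 x ∈ (g • c).lattice := by
  rw [Cusp.mem_lattice_iff] at hx ⊢
  have h : (g • c).1.submodule = c.1.submodule.map (extC g.1 : NC →ₗ[ℂ] NC) :=
    submodule_smul (extC g.1) c.1
  rw [h]
  refine ⟨_, hx, ?_⟩
  refine (extC_gaussVec g.1 x (-rho x)).trans ?_
  rw [map_neg, g.2.2]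

/-- The standard isotropic vector. -/
def stdIso : M := ((0, 1), 0, 0)

theorem stdIso_ne_zero : modelEquiv stdIso ≠ 0 := by
  rw [Ne, LinearEquiv.map_eq_zero_iff]
  intro h
  have := congrArg (fun v : M => v.1.2) h
  simp [stdIso] at this

theorem form_stdIso : form (modelEquiv stdIso) (modelEquiv stdIso) = 0 := by
  rw [form_modelEquiv_self]
  simp [halfNorm, halfNormD4, stdIso]

/-- The standard cusp. -/
def stdCusp : Cusp := Cusp.ofIsotropic _ stdIso_ne_zero form_stdIso

theorem stdIso_mem : modelEquiv stdIso ∈ stdCusp.lattice := Cusp.mem_lattice_ofIsotropic _ _ _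

theorem rho_mem_lattice {c : Cusp} {x : N} (h : x ∈ c.lattice) : rho x ∈ c.lattice := by
  rw [Cusp.mem_lattice_iff] at h ⊢
  have h1 := c.1.submodule.smul_mem Complex.I h
  rw [I_smul_gaussVec, neg_neg] at h1
  rwa [rho_rho, neg_neg]

theorem eq_of_polar_eq_zero {v : M} (h : ∀ w : M, w.1.1 = 0 → polar v w = 0) :
    v = ((0, v.1.2), 0, 0) := by
  have b1 := h ((0, 1), 0, 0) rfl
  have b2 := h ((0, gi), 0, 0) rfl
  have p1 := h (0, (1, 0), 0) rfl
  have p2 := h (0, (gi, 0), 0) rfl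
  have q1 := h (0, (0, 1), 0) rfl
  have q2 := h (0, (0, gi), 0) rfl
  have r1 := h (0, 0, (1, 0)) rfl
  have r2 := h (0, 0, (gi, 0)) rfl
  have s1 := h (0, 0, (0, 1)) rfl
  have s2 := h (0, 0, (0, gi)) rfl
  simp only [polar, halfNorm, halfNormD4, gi, Prod.fst_add, Prod.snd_add, Zsqrtd.re_add,
    Zsqrtd.im_add, Zsqrtd.re_zero, Zsqrtd.im_zero, Zsqrtd.re_one, Zsqrtd.im_one, Prod.fst_zero,
    Prod.snd_zero] at b1 b2 p1 p2 q1 q2 r1 r2 s1 s2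
  ring_nf at b1 b2 p1 p2 q1 q2 r1 r2 s1 s2
  refine Prod.ext (Prod.ext (Zsqrtd.ext ?_ ?_) rfl)
    (Prod.ext (Prod.ext (Zsqrtd.ext ?_ ?_) (Zsqrtd.ext ?_ ?_))
      (Prod.ext (Zsqrtd.ext ?_ ?_) (Zsqrtd.ext ?_ ?_))) <;>
  simp only [Prod.fst_zero, Prod.snd_zero, Zsqrtd.re_zero, Zsqrtd.im_zero] <;> omega

/-- A vector on the complex line of `stdIso` is orthogonal to everything with vanishing first
coordinate, which confines it to `ℤ[i] • stdIso`. -/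
theorem mem_lattice_stdCusp {v : M} (h : modelEquiv v ∈ stdCusp.lattice) :
    v = v.1.2 • stdIso := by
  have h1 : v = ((0, v.1.2), 0, 0) := by
    refine eq_of_polar_eq_zero fun w hw => ?_
    rw [Cusp.mem_lattice_iff, stdCusp, Cusp.ofIsotropic_submodule] at h
    obtain ⟨t, ht⟩ := Submodule.mem_span_singleton.1 h
    have h2 := formC_gaussVec (modelEquiv v) (-rho (modelEquiv v)) (modelEquiv w)
    have h3 : form (modelEquiv stdIso) (modelEquiv w) = 0 := by
      rw [form_modelEquiv]
      simp [polar, halfNorm, halfNormD4, stdIso, hw]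
    have h4 : form (-rho (modelEquiv stdIso)) (modelEquiv w) = 0 := by
      rw [rho_modelEquiv, map_neg, LinearMap.neg_apply, form_modelEquiv]
      simp [polar, halfNorm, halfNormD4, stdIso, hw]
    rw [← ht, map_smul, LinearMap.smul_apply, formC_gaussVec, h3, h4] at h2
    have hre := congrArg Complex.re h2
    simp at hre
    rw [← form_modelEquiv]
    exact_mod_cast hre.symm
  refine h1.trans ?_
  refine Prod.ext (Prod.ext ?_ ?_) (Prod.ext ?_ ?_) <;> simp [stdIso]

theorem exists_smul_eq_stdCusp (c : Cusp) : ∃ g : Gam, g • c = stdCusp := by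
  obtain ⟨x, hx0, hx, hc⟩ := c.exists_mem_lattice
  obtain ⟨v, rfl⟩ := modelEquiv.surjective x
  rw [form_modelEquiv_self] at hx
  obtain ⟨g, b, hg⟩ := exists_isotropic_normal_form v (by omega)
  refine ⟨toGam g, ?_⟩
  have h1 := Cusp.smul_mem_lattice (toGam g) hc
  rw [toGam_modelEquiv] at h1
  have hne : modelEquiv (g.1 v) ≠ 0 := by
    rw [Ne, LinearEquiv.map_eq_zero_iff, LinearEquiv.map_eq_zero_iff]
    rwa [Ne, LinearEquiv.map_eq_zero_iff] at hx0
  have hform : form (modelEquiv (g.1 v)) (modelEquiv (g.1 v)) = 0 := by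
    rw [form_modelEquiv_self, g.2]; exact hx
  have h2 : modelEquiv (g.1 v) ∈ stdCusp.lattice := by
    have e : g.1 v = b • stdIso := by
      rw [hg]
      refine Prod.ext (Prod.ext ?_ ?_) (Prod.ext ?_ ?_) <;> simp [stdIso]
    rw [e, gaussian_smul_eq, map_add, map_smul, map_smul, ← rho_modelEquiv]
    exact add_mem (Submodule.smul_mem _ _ stdIso_mem)
      (Submodule.smul_mem _ _ (rho_mem_lattice stdIso_mem))
  rw [Cusp.eq_ofIsotropic hne hform h1, Cusp.eq_ofIsotropic hne hform h2]

instance : MulAction.IsPretransitive Gam Cusp := by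
  constructor
  intro c c'
  obtain ⟨g, hg⟩ := exists_smul_eq_stdCusp c
  obtain ⟨g', hg'⟩ := exists_smul_eq_stdCusp c'
  exact ⟨g'⁻¹ * g, by rw [mul_smul, hg, ← hg', inv_smul_smul]⟩

/-! ### The class of a cusp and its stabilizer -/

theorem red_stdIso : red stdIso = pt 0 + pt 1 + (pt 2 + pt 3) := by
  simp only [red_apply, stdIso, map_one, Prod.fst_zero, Prod.snd_zero, map_zero]
  decide

theorem phi_stdIso : phi (modelEquiv stdIso) = edge 0 1 + edge 2 3 := by
  apply discEquiv.injective
  rw [discEquiv_phi, map_add, discEquiv_edge, discEquiv_edge, red_stdIso]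

theorem phi_stdIso_ne_zero : phi (modelEquiv stdIso) ≠ 0 := by
  rw [Ne, phi_eq_zero_iff, red_stdIso]
  decide +kernel

theorem phi_eq_phi_stdIso {x : N} (h : x ∈ stdCusp.lattice) (h0 : phi x ≠ 0) :
    phi x = phi (modelEquiv stdIso) := by
  obtain ⟨v, rfl⟩ := modelEquiv.surjective x
  have hv := mem_lattice_stdCusp h
  have e : modelEquiv v
      = v.1.2.re • modelEquiv stdIso + v.1.2.im • rho (modelEquiv stdIso) := by
    rw [rho_modelEquiv, ← map_smul, ← map_smul, ← map_add, ← gaussian_smul_eq, ← hv]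
  rw [e, phi_combination] at h0 ⊢
  exact (zsmul_AN _ _).resolve_left h0

theorem GamToOq_ne_zero (g : Gam) {α : AN} : (GamToOq g).1 α ≠ 0 ↔ α ≠ 0 :=
  not_congr (LinearEquiv.map_eq_zero_iff (GamToOq g).1)

theorem Cusp.phi_eq (c : Cusp) {x y : N} (hx : x ∈ c.lattice) (hy : y ∈ c.lattice)
    (hx0 : phi x ≠ 0) (hy0 : phi y ≠ 0) : phi x = phi y := by
  obtain ⟨g, hg⟩ := exists_smul_eq_stdCusp c
  have hx' := Cusp.smul_mem_lattice g hx
  have hy' := Cusp.smul_mem_lattice g hy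
  rw [hg] at hx' hy'
  rw [← GamToOq_ne_zero g, GamToOq_phi] at hx0 hy0
  apply (GamToOq g).1.injective
  rw [GamToOq_phi, GamToOq_phi, phi_eq_phi_stdIso hx' hx0, phi_eq_phi_stdIso hy' hy0]

theorem Cusp.exists_phi_ne_zero (c : Cusp) :
    ∃ x ∈ c.lattice, phi x ≠ 0 ∧ qN (phi x) = 0 := by
  obtain ⟨g, hg⟩ := exists_smul_eq_stdCusp c
  have h := Cusp.smul_mem_lattice g⁻¹ stdIso_mem
  rw [← hg, inv_smul_smul] at h
  refine ⟨_, h, ?_, ?_⟩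
  · rw [← GamToOq_phi, GamToOq_ne_zero]
    exact phi_stdIso_ne_zero
  · rw [← GamToOq_phi, (GamToOq g⁻¹).2, qN_phi_eq_zero_iff, red_stdIso]
    decide +kernel

/-- The non-zero class in the discriminant group of the lattice of a cusp. -/
def Cusp.cls (c : Cusp) : AN := phi c.exists_phi_ne_zero.choose

theorem Cusp.cls_ne_zero (c : Cusp) : c.cls ≠ 0 := c.exists_phi_ne_zero.choose_spec.2.1

theorem Cusp.cls_isotropic (c : Cusp) : qN c.cls = 0 := c.exists_phi_ne_zero.choose_spec.2.2

theorem Cusp.cls_eq (c : Cusp) {x : N} (hx : x ∈ c.lattice) (h0 : phi x ≠ 0) : c.cls = phi x :=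
  c.phi_eq c.exists_phi_ne_zero.choose_spec.1 hx c.exists_phi_ne_zero.choose_spec.2.1 h0

theorem Cusp.cls_smul (g : Gam) (c : Cusp) : (g • c).cls = (GamToOq g).1 c.cls := by
  obtain ⟨x, hx, h0, -⟩ := c.exists_phi_ne_zero
  rw [c.cls_eq hx h0, GamToOq_phi]
  refine Cusp.cls_eq _ (Cusp.smul_mem_lattice g hx) ?_
  rwa [← GamToOq_phi, GamToOq_ne_zero]

/-- If `phi v` were zero, `phi` would vanish on the whole lattice of the cusp, which contains a
vector of non-zero class. -/
theorem Cusp.phi_of_lattice_eq (c : Cusp) {v : N} (h : c.lattice = Submodule.span ℤ {v, rho v}) :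
    c.cls = phi v := by
  have hv : v ∈ c.lattice := h ▸ Submodule.subset_span (by simp)
  refine c.cls_eq hv fun h0 => ?_
  obtain ⟨x, hx, hx0, -⟩ := c.exists_phi_ne_zero
  rw [h, Submodule.mem_span_pair] at hx
  obtain ⟨m, n, rfl⟩ := hx
  rw [phi_combination, h0, smul_zero] at hx0
  exact hx0 rfl

/-- Lifts of the isotropic vectors of `F` to isotropic vectors. -/
def isoLift (x : F) : M :=
  ((if x.1 = 0 ∧ x.2.1 ≠ 0 ∧ x.2.2 ≠ 0 then 1 + gi
      else if x.1 = (0, 1) ∧ x.2.1 ≠ 0 then 2 else liftBit x.1.1,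
    if x.1 = 0 ∧ x.2.1 ≠ 0 ∧ x.2.2 ≠ 0 then 1 + gi
      else if x.1 = (1, 0) ∧ x.2.1 ≠ 0 then 2 else liftBit x.1.2),
    liftD4 x.2.1, liftD4 x.2.2)

/-- When both `D₄` parts are roots and the hyperbolic class is degenerate, the hyperbolic lift must
contribute 2; this explains the entries `1 + i` and 2. In the other isotropic cases the 0–1 lifts
already cancel. -/
theorem halfNorm_isoLift {x : F} : quad x = 0 → halfNorm (isoLift x) = 0 := by
  revert x; decide +kernel

theorem red_isoLift (x : F) : red (isoLift x) = x := by
  have h2 : parity 2 = 0 := by rw [map_ofNat]; rfl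
  have h3 : parity (1 + gi) = 0 := by rw [map_add, map_one, parity_gi]; decide
  have hl := congrArg (fun y : F => y.2) (red_rootLift x)
  refine Prod.ext (Prod.ext ?_ ?_) hl
  · change parity (if _ then _ else if _ then _ else _) = _
    split_ifs with h h'
    · rw [h3, h.1]; rfl
    · rw [h2, h'.1]
    · exact parity_liftBit _
  · change parity (if _ then _ else if _ then _ else _) = _
    split_ifs with h h'
    · rw [h3, h.1]; rfl
    · rw [h2, h'.1]
    · exact parity_liftBit _

/-- Pairing with `stdIso` sees only the first coordinate, which is 0 on the points 0–3 and 1 on the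
points 4–7; so it vanishes on pairs inside a block. -/
theorem herm_stdIso_rootLift {i j : Fin 8} : (i < 4 ↔ j < 4) → i ≠ j →
    herm stdIso (rootLift (pt i + pt j)) = 0 := by
  revert i j; decide +kernel

/-- A four-set is determined by its vector up to complement, so these four points form one of the
two blocks. -/
theorem mem_block {a b c d : Fin 8} : a ≠ b → a ≠ c → a ≠ d → b ≠ c → b ≠ d → c ≠ d →
    pt a + pt b + (pt c + pt d) = pt 0 + pt 1 + (pt 2 + pt 3) →
    ∀ i, (i < 4 ↔ a < 4) ↔ (i = a ∨ i = b ∨ i = c ∨ i = d) := by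
  revert a b c d; decide +kernel

theorem toGam_smul_stdCusp {g : U} (h : g.1 stdIso = stdIso) : toGam g • stdCusp = stdCusp := by
  have h1 := Cusp.smul_mem_lattice (toGam g) stdIso_mem
  rw [toGam_modelEquiv, h] at h1
  exact Cusp.eq_ofIsotropic stdIso_ne_zero form_stdIso h1

theorem gamPerm_d4Swap : gamPerm (toGam d4Swap) = Equiv.addRight 4 := by
  refine gamPerm_toGam fun v k l hv => ?_
  have h1 : red (d4Swap.1 v) = ((red v).1, (red v).2.2, (red v).2.1) := rfl
  rw [h1, hv]
  revert k l
  have : ∀ k l : Fin 8, ((pt k + pt l).1, (pt k + pt l).2.2, (pt k + pt l).2.1)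
      = pt (Equiv.addRight 4 k) + pt (Equiv.addRight 4 l) := by decide +kernel
  exact fun k l _ => this k l

theorem map_inv_mul_eq {G Q : Type*} [Group G] [Group Q] (θ : G →* Q) {d s g : G}
    (h : θ d = θ (s * g)) : θ (s⁻¹ * d) = θ g := by
  rw [map_mul, h, map_mul, map_inv, inv_mul_cancel_left]

theorem pt_add_eq_of_edge_add_eq {a b c d a' b' c' d' : Fin 8}
    (h : edge a b + edge c d = edge a' b' + edge c' d') :
    pt a + pt b + (pt c + pt d) = pt a' + pt b' + (pt c' + pt d') := by
  have h1 := congrArg discEquiv h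
  rwa [map_add, map_add, discEquiv_edge, discEquiv_edge, discEquiv_edge, discEquiv_edge] at h1

theorem block_of_apply_phi_stdIso {g : Gam}
    (hg : (GamToOq g).1 (phi (modelEquiv stdIso)) = phi (modelEquiv stdIso)) (i : Fin 8) :
    (gamPerm g i < 4 ↔ gamPerm g 0 < 4) ↔ i < 4 := by
  have h1 : edge (gamPerm g 0) (gamPerm g 1) + edge (gamPerm g 2) (gamPerm g 3)
      = edge 0 1 + edge 2 3 := by
    rw [phi_stdIso] at hg
    rw [← GamToOq_edge g 0 1, ← GamToOq_edge g 2 3]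
    exact (map_add (GamToOq g).1 _ _).symm.trans hg
  have hpt := pt_add_eq_of_edge_add_eq h1
  generalize gamPerm g = σ at hpt
  have hne : ∀ {i j : Fin 8}, i ≠ j → σ i ≠ σ j := fun h => σ.injective.ne h
  rw [mem_block (hne (by decide)) (hne (by decide)) (hne (by decide)) (hne (by decide))
    (hne (by decide)) (hne (by decide)) hpt]
  simp only [σ.injective.eq_iff]
  revert i; decide

theorem equivalence_block : Equivalence (fun i j : Fin 8 => (i < 4 ↔ j < 4)) :=
  ⟨fun _ => Iff.rfl, Iff.symm, Iff.trans⟩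

theorem pairReflection_smul_stdCusp (i j : Fin 8) (h : i ≠ j) (hij : i < 4 ↔ j < 4) :
    toGam (pairReflection h) • stdCusp = stdCusp := by
  refine toGam_smul_stdCusp ?_
  rw [pairReflection, reflection_apply, herm_stdIso_rootLift hij h, zero_smul, add_zero]

theorem d4Swap_smul_stdCusp : toGam d4Swap • stdCusp = stdCusp :=
  toGam_smul_stdCusp (by rw [d4Swap_apply]; rfl)

theorem exists_stabilizer_stdCusp (g : Gam)
    (hg : (GamToOq g).1 (phi (modelEquiv stdIso)) = phi (modelEquiv stdIso)) :
    ∃ d : Gam, d • stdCusp = stdCusp ∧ GamToOq d = GamToOq g := by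
  have hblock := block_of_apply_phi_stdIso hg
  by_cases h0 : gamPerm g 0 < 4
  · exact exists_stabilizer_lift stdCusp _ equivalence_block pairReflection_smul_stdCusp g
      fun i => by
        have := hblock i
        tauto
  -- The blocks are interchanged here; the exchange of the two `D₄`, which fixes the cusp, reduces
  -- to a permutation in `S₄ × S₄`.
  · obtain ⟨d, hd, hd'⟩ := exists_stabilizer_lift stdCusp _ equivalence_block
      pairReflection_smul_stdCusp (toGam d4Swap * g) (by
        intro i
        have h1 := hblock i
        have h2 : ∀ k : Fin 8, Equiv.addRight 4 k < 4 ↔ ¬ k < 4 := by decide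
        rw [map_mul, gamPerm_d4Swap, Equiv.Perm.mul_apply, h2]
        tauto)
    refine ⟨(toGam d4Swap)⁻¹ * d, ?_, map_inv_mul_eq GamToOq hd'⟩
    rw [mul_smul, hd, inv_smul_eq_iff]
    exact d4Swap_smul_stdCusp.symm

theorem Cusp.exists_cls_eq {α : AN} (hα0 : α ≠ 0) (hα : qN α = 0) : ∃ c : Cusp, c.cls = α := by
  obtain ⟨v, hv, hv'⟩ : ∃ v, halfNorm v = 0 ∧ phi (modelEquiv v) = α := by
    rw [qN_eq_zero_iff] at hα
    exact ⟨_, halfNorm_isoLift hα, discEquiv.injective (by rw [discEquiv_phi, red_isoLift])⟩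
  subst hv'
  have hne : modelEquiv v ≠ 0 := by
    intro h
    rw [h] at hα0
    exact hα0 (map_zero phiLin)
  have hform : form (modelEquiv v) (modelEquiv v) = 0 := by
    rw [form_modelEquiv_self, hv, mul_zero]
  exact ⟨Cusp.ofIsotropic _ hne hform,
    Cusp.cls_eq _ (Cusp.mem_lattice_ofIsotropic _ hne hform) hα0⟩

theorem exists_orbit_equiv_Cusp :
    ∃ E : MulAction.orbitRel.Quotient GamOneSubI Cusp ≃ {α : AN // α ≠ 0 ∧ qN α = 0},
      ∀ (c : Cusp) (v : N), c.lattice = Submodule.span ℤ {v, rho v} →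
        (E (Quotient.mk _ c)).1 = phi v := by
  have hcls : stdCusp.cls = phi (modelEquiv stdIso) :=
    Cusp.cls_eq _ stdIso_mem phi_stdIso_ne_zero
  obtain ⟨E, hE⟩ := exists_orbit_equiv Cusp.cls (fun α => α ≠ 0 ∧ qN α = 0)
    (fun c => ⟨c.cls_ne_zero, c.cls_isotropic⟩)
    (fun α hα => Cusp.exists_cls_eq hα.1 hα.2)
    Cusp.cls_smul stdCusp exists_smul_eq_stdCusp (by
      intro g hg
      rw [hcls] at hg
      exact exists_stabilizer_stdCusp g hg)
  exact ⟨E, fun c v h => (hE c).trans (c.phi_of_lattice_eq h)⟩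

/-! ### Counting -/

theorem card_nonisotropic : Nat.card {α : AN // qN α ≠ 0} = 28 := by
  have e : {α : AN // qN α ≠ 0} ≃ {x : F // quad x ≠ 0} :=
    discEquiv.toEquiv.subtypeEquiv fun α => not_congr (qN_eq_zero_iff α)
  rw [Nat.card_congr e, Nat.card_eq_fintype_card]
  decide +kernel

theorem card_isotropic : Nat.card {α : AN // α ≠ 0 ∧ qN α = 0} = 35 := by
  have e : {α : AN // α ≠ 0 ∧ qN α = 0} ≃ {x : F // x ≠ 0 ∧ quad x = 0} :=
    discEquiv.toEquiv.subtypeEquiv fun α =>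
      and_congr (not_congr (LinearEquiv.map_eq_zero_iff discEquiv).symm) (qN_eq_zero_iff α)
  rw [Nat.card_congr e, Nat.card_eq_fintype_card]
  decide +kernel

end EightPoints

end

open EightPoints
theorem proposition4p7 :
    -- (i)
    Nonempty ((Gam ⧸ GamOneSubI) ≃* Equiv.Perm (Fin 8)) ∧
    -- (ii)
    MulAction.IsPretransitive Gam Cusp ∧
    MulAction.IsPretransitive Gam RhoA1A1 ∧
    -- (iii)
    (∃ F : MulAction.orbitRel.Quotient GamOneSubI RhoA1A1 ≃ {α : AN // qN α ≠ 0},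
      ∀ (R : RhoA1A1) (r : N), r ∈ R.1 → form r r = -2 →
        (F (Quotient.mk _ R)).1 = phi r) ∧
    Nat.card {α : AN // qN α ≠ 0} = 28 ∧
    (∃ G : MulAction.orbitRel.Quotient GamOneSubI Cusp ≃ {α : AN // α ≠ 0 ∧ qN α = 0},
      ∀ (c : Cusp) (v : N), c.lattice = Submodule.span ℤ {v, rho v} →
        (G (Quotient.mk _ c)).1 = phi v) ∧
    Nat.card {α : AN // α ≠ 0 ∧ qN α = 0} = 35 :=
  ⟨⟨quotientEquivPerm⟩, inferInstance, inferInstance, exists_orbit_equiv_RhoA1A1,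
    card_nonisotropic, exists_orbit_equiv_Cusp, card_isotropic⟩
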